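/- Let $d\ge 1$ be an integer, $\alpha\in(0,2]$, $\beta\in(0,1)$ and $\nu>0$. Let $X=\{X(s)\}_{s\ge 0}$ be an isotropic $\alpha$-stable Lévy process in $\mathbb R^d$ with $\mathbb E\,e^{i\xi\cdot X(s)}=e^{-s\nu|\xi|^\alpha}$ for $s\ge 0$, $\xi\in\mathbb R^d$, and let $D=\{D(r)\}_{r\ge0}$ be a $\beta$-stable subordinator, independent of $X$, with $\mathbb E\,e^{-\lambda D(r)}=e^{-r\lambda^\beta}$ for $r\ge 0$, $\lambda>0$. For $t>0$ let $E_t=\inf\{u\ge 0: D(u)>t\}$, and let $G_t$ denote the density (with respect to Lebesgue measure) of $X(E_t)$; it is the fundamental solution of $\partial_t^\beta G_t(x)=-\nu(-\Delta)^{\alpha/2}G_t(x)$. Let $E_\beta(x)=\sum_{k=0}^\infty \frac{x^k}{\Gamma(1+\beta k)}$ be the Mittag-Leffler function. Then $$\int_0^\infty z^{d/\alpha-1}\,(E_\beta(-z))^2\,dz<\infty\quad\text{if and only if}\quad d<2\alpha .$$ Moreover, if $d<2\alpha$, then for every $t>0$ the law of $X(E_t)$ has a density $G_t$, this density is square integrable,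 and $$\int_{\mathbb R^d} G_t(x)^2\,dx = C^*\,t^{-\beta d/\alpha},\qquad C^*=\frac{\nu^{-d/\alpha}\,2\pi^{d/2}}{\alpha\,\Gamma(d/2)}\,\frac{1}{(2\pi)^d}\int_0^\infty z^{d/\alpha-1}\,(E_\beta(-z))^2\,dz .$$ -/

import Mathlib

open MeasureTheory ProbabilityTheory Set Filter Topology
open scoped NNReal ENNReal

noncomputable section

/-- The Mittag-Leffler function `E_β(x) = ∑_{k ≥ 0} x ^ k / Γ(1 + β k)`. -/
def mittagLeffler (β x : ℝ) : ℝ :=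
  ∑' k : ℕ, x ^ k / Real.Gamma (1 + β * k)

/-- `X` is a Lévy process: it starts at `0` almost surely, has independent and stationary
increments, and almost all of its paths are right-continuous with left limits. (Stochastic
continuity follows from these properties. At `t = 0` the left limit condition is empty.) -/
structure IsLevyProcess {Ω E : Type*} [MeasurableSpace Ω] [NormedAddCommGroup E]
    [MeasurableSpace E] [BorelSpace E] (X : ℝ≥0 → Ω → E) (P : Measure Ω) : Prop where
  measurable : ∀ t, Measurable (X t)
  zero : ∀ᵐ ω ∂P, X 0 ω = 0
  indep_increments : HasIndepIncrements X P
  stationary_increments : ∀ s t, IdentDistrib (fun ω => X (s + t) ω - X s ω) (X t) P P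
  cadlag : ∀ᵐ ω ∂P, ∀ t : ℝ≥0,
    ContinuousWithinAt (fun u => X u ω) (Ici t) t ∧
      ∃ l : E, Tendsto (fun u => X u ω) (𝓝[<] t) (𝓝 l)

/-- `X` is an isotropic `α`-stable Lévy process in `ℝ^d` with generator `-ν (-Δ)^(α/2)`:
a Lévy process with `𝔼 exp(i ξ · X_s) = exp(-s ν |ξ|^α)`. -/
structure IsIsotropicStableProcess {Ω : Type*} [MeasurableSpace Ω] {d : ℕ} (α ν : ℝ)
    (X : ℝ≥0 → Ω → EuclideanSpace ℝ (Fin d)) (P : Measure Ω) : Prop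
    extends IsLevyProcess X P where
  charFun_eq : ∀ (s : ℝ≥0) (ξ : EuclideanSpace ℝ (Fin d)),
    charFun (P.map (X s)) ξ = Complex.exp (-((s * ν * ‖ξ‖ ^ α : ℝ) : ℂ))

/-- `D` is a (standard) `β`-stable subordinator: a real Lévy process with almost surely
nondecreasing paths and `𝔼 exp(-l D_r) = exp(-r l^β)` for `l > 0`. -/
structure IsStableSubordinator {Ω : Type*} [MeasurableSpace Ω] (β : ℝ)
    (D : ℝ≥0 → Ω → ℝ) (P : Measure Ω) : Prop extends IsLevyProcess D P where
  monotone : ∀ᵐ ω ∂P, Monotone (fun r => D r ω)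
  laplace_eq : ∀ (r : ℝ≥0) (l : ℝ), 0 < l →
    ∫ ω, Real.exp (-(l * D r ω)) ∂P = Real.exp (-(r * l ^ β))

/-- The first passage time `E_t = inf {u : D(u) > t}`. -/
def firstPassage {Ω : Type*} (D : ℝ≥0 → Ω → ℝ) (t : ℝ) (ω : Ω) : ℝ≥0 :=
  sInf {u : ℝ≥0 | t < D u ω}

/-- The time-changed random variable `X(E_t)`. -/
def timeChanged {Ω E : Type*} (X : ℝ≥0 → Ω → E) (D : ℝ≥0 → Ω → ℝ) (t : ℝ) (ω : Ω) : E :=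
  X (firstPassage D t ω) ω

/-- The kernel `G_t(x)`: the density of `X(E_t)` with respect to Lebesgue measure. -/
def greenKernel {Ω : Type*} [MeasurableSpace Ω] {d : ℕ} (P : Measure Ω)
    (X : ℝ≥0 → Ω → EuclideanSpace ℝ (Fin d)) (D : ℝ≥0 → Ω → ℝ)
    (t : ℝ) (x : EuclideanSpace ℝ (Fin d)) : ℝ :=
  (pdf (timeChanged X D t) P volume x).toReal

/-- The constant
`C* = ν^(-d/α) 2 π^(d/2) / (α Γ(d/2)) · (2π)^(-d) · ∫_0^∞ z^(d/α-1) E_β(-z)^2 dz`. -/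
def greenConst (d : ℕ) (α β ν : ℝ) : ℝ :=
  ν ^ (-((d : ℝ) / α)) * (2 * Real.pi ^ ((d : ℝ) / 2)) / (α * Real.Gamma ((d : ℝ) / 2)) *
    (1 / (2 * Real.pi) ^ d) *
    ∫ z in Ioi (0 : ℝ), z ^ ((d : ℝ) / α - 1) * mittagLeffler β (-z) ^ 2

end

/-!
The random variable `Y = D_1` is positive `β`-stable, and everything rests on its Laplace transform
`𝔼 exp(-l Y) = exp(-l^β)`.

*The Mittag-Leffler function.* Integrating `exp(-s^β)` against `s^{βk-1} ds` gives the moments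
`𝔼 (Y^{-β})^k = k! / Γ(1 + β k)`, so that `E_β(-z) = 𝔼 exp(-z Y^{-β})` for `z ≥ 0`
(`IsPositiveStable.mittagLeffler_neg`). Comparing `exp(-z Y^{-β})` pointwise with `1 - exp(-s Y)`,
where `s` is of the order of `z^{-1/β}`, shows that `E_β(-z)` is of exact order `1 / z` at infinity
(`exists_mittagLeffler_neg_le`, `exists_le_mittagLeffler_neg`). Hence `z^{d/α-1} E_β(-z)^2` behaves
like `z^{d/α-3}` there, and like `z^{d/α-1}` near `0`: it is integrable if and only if `d < 2 α`.

*The law of `X(E_t)`.* Since Laplace transforms determine laws on `[0, ∞)`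
(`map_eq_of_laplace_eq`), `D_r` has the law of `r^{1/β} Y`; as `{E_t ≥ u}` and `{D_u ≤ t}` agree up
to boundary effects, `E_t` has the law of `(t / Y)^β` (`IsStableSubordinator.map_firstPassage`), so
`𝔼 exp(-l E_t) = E_β(-l t^β)`. Independence and right-continuity of the paths of `X` then yield the
characteristic function `E_β(-ν |ξ|^α t^β)` of `X(E_t)` (`charFun_timeChanged`).

*Plancherel.* A finite measure whose characteristic function is square integrable has a square
integrable density with the `L²` norm predicted by Plancherel's formula
(`absolutelyContinuous_and_integral_rnDeriv_sq`). In polar coordinates and after the substitution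
`z = ν t^β |ξ|^α` the `L²` norm of the characteristic function becomes the integral of
`z^{d/α-1} E_β(-z)^2`.
-/

/-! ### Uniqueness of Laplace transforms -/

theorem integrable_exp_mul_of_nonpos {Ω : Type*} [MeasurableSpace Ω] {P : Measure Ω}
    [IsFiniteMeasure P] {A : Ω → ℝ} (hA : AEMeasurable A P) (hA0 : ∀ᵐ ω ∂P, 0 ≤ A ω)
    {t : ℝ} (ht : t ≤ 0) : Integrable (fun ω => Real.exp (t * A ω)) P := by
  refine Integrable.of_bound (by fun_prop) 1 ?_
  filter_upwards [hA0] with ω hω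
  rw [Real.norm_of_nonneg (Real.exp_pos _).le, Real.exp_le_one_iff]
  exact mul_nonpos_of_nonpos_of_nonneg ht hω

theorem Iio_zero_subset_interior_integrableExpSet {Ω : Type*} [MeasurableSpace Ω]
    {P : Measure Ω} [IsFiniteMeasure P] {A : Ω → ℝ} (hA : AEMeasurable A P)
    (hA0 : ∀ᵐ ω ∂P, 0 ≤ A ω) : Iio 0 ⊆ interior (integrableExpSet A P) :=
  interior_maximal (fun _ ht => integrable_exp_mul_of_nonpos hA hA0 (le_of_lt ht)) isOpen_Iio

theorem tendsto_complexMGF_charFun {Ω : Type*} [MeasurableSpace Ω] {P : Measure Ω}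
    [IsFiniteMeasure P] {A : Ω → ℝ} (hA : AEMeasurable A P) (hA0 : ∀ᵐ ω ∂P, 0 ≤ A ω) (t : ℝ) :
    Tendsto (fun n : ℕ => complexMGF A P (-((1 / ((n : ℝ) + 1) : ℝ) : ℂ) + t * Complex.I)) atTop
      (𝓝 (charFun (P.map A) t)) := by
  rw [← complexMGF_mul_I hA]
  refine tendsto_integral_of_dominated_convergence (fun _ => 1) (fun n => ?_)
    (integrable_const _) (fun n => ?_) ?_
  · have : AEMeasurable (fun ω => (A ω : ℂ)) P := Complex.measurable_ofReal.comp_aemeasurable hA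
    exact (Complex.measurable_exp.comp_aemeasurable (this.const_mul _)).aestronglyMeasurable
  · filter_upwards [hA0] with ω hω
    rw [Complex.norm_exp, Real.exp_le_one_iff]
    have : (0 : ℝ) ≤ 1 / ((n : ℝ) + 1) := by positivity
    simp only [Complex.mul_re, Complex.add_re, Complex.neg_re, Complex.ofReal_re, Complex.I_re,
      Complex.ofReal_im, Complex.I_im, mul_zero, mul_one, sub_zero, add_zero, sub_self]
    nlinarith
  · refine Eventually.of_forall fun ω => ?_
    have h1 : Tendsto (fun n : ℕ => ((1 / ((n : ℝ) + 1) : ℝ) : ℂ)) atTop (𝓝 0) := by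
      have := (Complex.continuous_ofReal.tendsto 0).comp
        (tendsto_one_div_add_atTop_nhds_zero_nat (𝕜 := ℝ))
      simpa [Function.comp_def] using this
    have h2 := ((h1.neg.add_const (t * Complex.I)).mul_const (A ω : ℂ)).cexp
    simpa using h2

/-- A law on `[0, ∞)` is determined by its Laplace transform: both transforms extend analytically to
the left half-plane, where they agree by the identity theorem, and the characteristic
functions are their boundary values. -/
theorem map_eq_of_laplace_eq {Ω Ω' : Type*} [MeasurableSpace Ω] [MeasurableSpace Ω']
    {P : Measure Ω} {P' : Measure Ω'} [IsFiniteMeasure P] [IsFiniteMeasure P']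
    {A : Ω → ℝ} {B : Ω' → ℝ} (hA : AEMeasurable A P) (hB : AEMeasurable B P')
    (hA0 : ∀ᵐ ω ∂P, 0 ≤ A ω) (hB0 : ∀ᵐ ω ∂P', 0 ≤ B ω)
    (h : ∀ l : ℝ, 0 < l →
      ∫ ω, Real.exp (-(l * A ω)) ∂P = ∫ ω, Real.exp (-(l * B ω)) ∂P') :
    P.map A = P'.map B := by
  have hpos : ∀ n : ℕ, (0 : ℝ) < 1 / ((n : ℝ) + 1) := fun n => by positivity
  have hlim : Tendsto (fun n : ℕ => -1 + ((1 / ((n : ℝ) + 1) : ℝ) : ℂ)) atTop (𝓝[≠] (-1)) := by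
    refine tendsto_nhdsWithin_iff.2 ⟨?_, Eventually.of_forall fun n => ?_⟩
    · have := (Complex.continuous_ofReal.tendsto 0).comp
        (tendsto_one_div_add_atTop_nhds_zero_nat (𝕜 := ℝ))
      simpa [Function.comp_def] using this.const_add (-1 : ℂ)
    · have := (hpos n).ne'
      simpa only [mem_compl_iff, mem_singleton_iff, add_eq_left, Complex.ofReal_eq_zero] using this
  have hfreq : ∃ᶠ z in 𝓝[≠] (-1 : ℂ), complexMGF A P z = complexMGF B P' z := by
    refine hlim.frequently (Eventually.frequently ?_)
    filter_upwards [eventually_gt_atTop 0] with n hn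
    have hlt : 1 / ((n : ℝ) + 1) < 1 := by
      rw [div_lt_one (by positivity)]
      have : (0 : ℝ) < n := by exact_mod_cast hn
      linarith
    have e : (-1 : ℂ) + ((1 / ((n : ℝ) + 1) : ℝ) : ℂ) = ((-(1 - 1 / ((n : ℝ) + 1)) : ℝ) : ℂ) := by
      push_cast; ring
    rw [e, complexMGF_ofReal, complexMGF_ofReal]
    have := h (1 - 1 / ((n : ℝ) + 1)) (by linarith)
    simp only [mgf, neg_mul]
    exact_mod_cast this
  have hset : IsPreconnected {z : ℂ | z.re < 0} := (convex_halfSpace_re_lt 0).isPreconnected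
  have heq : EqOn (complexMGF A P) (complexMGF B P') {z : ℂ | z.re < 0} :=
    AnalyticOnNhd.eqOn_of_preconnected_of_frequently_eq
      (analyticOnNhd_complexMGF.mono
        fun z hz => Iio_zero_subset_interior_integrableExpSet hA hA0 hz)
      (analyticOnNhd_complexMGF.mono
        fun z hz => Iio_zero_subset_interior_integrableExpSet hB hB0 hz)
      hset (by simp) hfreq
  refine Measure.ext_of_charFun (funext fun t => ?_)
  refine tendsto_nhds_unique (tendsto_complexMGF_charFun hA hA0 t) ?_
  refine (tendsto_complexMGF_charFun hB hB0 t).congr fun n => (heq ?_).symm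
  have := hpos n
  simpa only [mem_ofPred_eq, Complex.mul_re, Complex.add_re, Complex.neg_re, Complex.ofReal_re,
    Complex.I_re, Complex.ofReal_im, Complex.I_im, mul_zero, mul_one, zero_mul, sub_zero, add_zero,
    sub_self, neg_lt_zero] using this

/-! ### Positive stable random variables and the Mittag-Leffler function -/

/-- `Y` is a positive `β`-stable random variable, normalised by `𝔼 exp(-l Y) = exp(-l^β)`. -/
structure IsPositiveStable {Ω : Type*} [MeasurableSpace Ω] (β : ℝ) (Y : Ω → ℝ)
    (P : Measure Ω) : Prop where
  measurable : Measurable Y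
  nonneg : ∀ᵐ ω ∂P, 0 ≤ Y ω
  laplace_eq : ∀ l : ℝ, 0 < l → ∫ ω, Real.exp (-(l * Y ω)) ∂P = Real.exp (-l ^ β)

/-- `Γ(1 + p) ≥ A^p e^{-A}`: restrict the Euler integral to `[A, ∞)`. -/
theorem rpow_mul_exp_neg_le_Gamma_one_add {A p : ℝ} (hA : 0 ≤ A) (hp : 0 ≤ p) :
    A ^ p * Real.exp (-A) ≤ Real.Gamma (1 + p) := by
  have hint : IntegrableOn (fun x : ℝ => Real.exp (-x) * x ^ p) (Ioi 0) := by
    have := Real.GammaIntegral_convergent (s := 1 + p) (by linarith)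
    simpa using this
  rw [Real.Gamma_eq_integral (by linarith), add_sub_cancel_left]
  calc A ^ p * Real.exp (-A) = ∫ x in Ioi A, A ^ p * Real.exp (-x) := by
        rw [integral_const_mul, integral_exp_neg_Ioi]
    _ ≤ ∫ x in Ioi A, Real.exp (-x) * x ^ p := by
        refine setIntegral_mono_on ((integrableOn_exp_neg_Ioi A).const_mul _)
          (hint.mono_set (Ioi_subset_Ioi hA)) measurableSet_Ioi fun x hx => ?_
        rw [mul_comm]
        gcongr
        exact (mem_Ioi.1 hx).le
    _ ≤ ∫ x in Ioi 0, Real.exp (-x) * x ^ p := by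
        refine setIntegral_mono_set hint ?_ (Ioi_subset_Ioi hA).eventuallyLE
        filter_upwards [ae_restrict_mem measurableSet_Ioi] with x hx
        have : (0 : ℝ) < x := hx
        positivity

theorem summable_pow_div_Gamma {β : ℝ} (hβ : 0 < β) {z : ℝ} (hz : 0 ≤ z) :
    Summable fun k : ℕ => z ^ k / Real.Gamma (1 + β * k) := by
  -- `A` is chosen so that `A ^ β = 2 z + 1`, which makes the majorant geometric of ratio `< 1 / 2`.
  set A : ℝ := (2 * z + 1) ^ (1 / β) with hAdef
  have hA : 0 < A := by positivity
  have hAβ : A ^ β = 2 * z + 1 := by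
    rw [hAdef, ← Real.rpow_mul (by positivity), one_div_mul_cancel hβ.ne', Real.rpow_one]
  have hr : z / (2 * z + 1) < 1 := by rw [div_lt_one (by positivity)]; linarith
  refine Summable.of_nonneg_of_le (fun k => ?_) (fun k => ?_)
    ((summable_geometric_of_lt_one (by positivity) hr).mul_left (Real.exp A))
  · have : 0 < Real.Gamma (1 + β * k) := Real.Gamma_pos_of_pos (by positivity)
    positivity
  · have h := rpow_mul_exp_neg_le_Gamma_one_add hA.le (p := β * k) (by positivity)
    rw [Real.rpow_mul hA.le, hAβ, Real.rpow_natCast, Real.exp_neg] at h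
    rw [div_pow, div_le_iff₀ (Real.Gamma_pos_of_pos (by positivity))]
    calc z ^ k = Real.exp A * (z ^ k / (2 * z + 1) ^ k) *
          ((2 * z + 1) ^ k * (Real.exp A)⁻¹) := by
          field_simp
      _ ≤ _ := by gcongr

namespace IsPositiveStable

variable {Ω : Type*} [MeasurableSpace Ω] {β : ℝ} {Y : Ω → ℝ} {P : Measure Ω}
  [IsProbabilityMeasure P]

theorem pos (hY : IsPositiveStable β Y P) (hβ : 0 < β) : ∀ᵐ ω ∂P, 0 < Y ω := by
  have hle : ∀ l : ℝ, 0 < l → P.real {ω | Y ω ≤ 0} ≤ Real.exp (-l ^ β) := by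
    intro l hl
    have hint : Integrable (fun ω => Real.exp (-(l * Y ω))) P := by
      simpa using integrable_exp_mul_of_nonpos hY.measurable.aemeasurable hY.nonneg
        (t := -l) (by linarith)
    have h := mul_meas_ge_le_integral_of_nonneg
      (Eventually.of_forall fun ω => (Real.exp_pos (-(l * Y ω))).le) hint 1
    rw [hY.laplace_eq l hl, one_mul] at h
    refine le_trans (measureReal_mono fun ω hω => ?_) h
    have hω' : Y ω ≤ 0 := hω
    show 1 ≤ Real.exp (-(l * Y ω))
    rw [Real.one_le_exp_iff]
    nlinarith
  have hlim : Tendsto (fun l : ℝ => Real.exp (-l ^ β)) atTop (𝓝 0) :=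
    Real.tendsto_exp_neg_atTop_nhds_zero.comp (tendsto_rpow_atTop hβ)
  have h0 : P.real {ω | Y ω ≤ 0} ≤ 0 :=
    ge_of_tendsto hlim ((eventually_gt_atTop 0).mono hle)
  have h1 : P {ω | Y ω ≤ 0} = 0 := by
    rw [← measureReal_eq_zero_iff]
    exact le_antisymm h0 measureReal_nonneg
  simpa [ae_iff] using h1

/-- Negative moments, from `Γ(p) Y^{-p} = ∫ s^{p-1} e^{-sY} ds` and Tonelli. -/
theorem lintegral_rpow_neg (hY : IsPositiveStable β Y P) (hβ : 0 < β) {p : ℝ} (hp : 0 < p) :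
    ∫⁻ ω, ENNReal.ofReal (Y ω ^ (-p)) ∂P =
      ENNReal.ofReal (Real.Gamma (p / β) / (β * Real.Gamma p)) := by
  have hΓ : 0 < Real.Gamma p := Real.Gamma_pos_of_pos hp
  have hΓ' : 0 < Real.Gamma (p / β) := Real.Gamma_pos_of_pos (by positivity)
  have key : ∀ᵐ ω ∂P, ENNReal.ofReal (Real.Gamma p) * ENNReal.ofReal (Y ω ^ (-p)) =
      ∫⁻ s in Ioi (0 : ℝ), ENNReal.ofReal (s ^ (p - 1) * Real.exp (-(Y ω * s))) := by
    filter_upwards [hY.pos hβ] with ω hω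
    have h := Real.integral_rpow_mul_exp_neg_mul_Ioi hp hω
    rw [← ofReal_integral_eq_lintegral_ofReal, h, ← ENNReal.ofReal_mul hΓ.le, one_div,
      Real.inv_rpow hω.le, Real.rpow_neg hω.le, mul_comm]
    -- A Bochner integral with nonzero value has an integrable integrand.
    · refine not_imp_comm.1 integral_undef (h.trans_ne ?_)
      positivity
    · filter_upwards [ae_restrict_mem measurableSet_Ioi] with s hs
      have : (0 : ℝ) < s := hs
      positivity
  have hswap : ∫⁻ ω, (∫⁻ s in Ioi (0 : ℝ),
        ENNReal.ofReal (s ^ (p - 1) * Real.exp (-(Y ω * s)))) ∂P =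
      ENNReal.ofReal (1 / β * Real.Gamma (p / β)) := by
    have hm := hY.measurable
    rw [lintegral_lintegral_swap (by fun_prop)]
    have h := integral_rpow_mul_exp_neg_rpow hβ (q := p - 1) (by linarith)
    rw [sub_add_cancel] at h
    rw [← h, ofReal_integral_eq_lintegral_ofReal]
    · refine setLIntegral_congr_fun measurableSet_Ioi fun s hs => ?_
      have hs0 : (0 : ℝ) < s := hs
      have hint : Integrable (fun ω => Real.exp (-(s * Y ω))) P := by
        simpa using integrable_exp_mul_of_nonpos hY.measurable.aemeasurable hY.nonneg
          (t := -s) (by linarith)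
      rw [ENNReal.ofReal_mul (by positivity), ← hY.laplace_eq s hs0,
        ofReal_integral_eq_lintegral_ofReal hint
          (Eventually.of_forall fun ω => (Real.exp_pos _).le),
        ← lintegral_const_mul _ (by fun_prop)]
      refine lintegral_congr fun ω => ?_
      rw [ENNReal.ofReal_mul (by positivity), mul_comm (Y ω)]
    -- A Bochner integral with nonzero value has an integrable integrand.
    · refine not_imp_comm.1 integral_undef (h.trans_ne ?_)
      positivity
    · filter_upwards [ae_restrict_mem measurableSet_Ioi] with s hs
      have : (0 : ℝ) < s := hs
      positivity
  rw [← lintegral_congr_ae key, lintegral_const_mul _ (by have := hY.measurable; fun_prop)] at hswap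
  have hne : ENNReal.ofReal (Real.Gamma p) ≠ 0 := by simpa using hΓ
  rw [← ENNReal.mul_right_inj hne ENNReal.ofReal_ne_top, hswap, ← ENNReal.ofReal_mul hΓ.le]
  congr 1
  field_simp

theorem integrable_and_integral_pow (hY : IsPositiveStable β Y P) (hβ : 0 < β) (k : ℕ) :
    Integrable (fun ω => (Y ω ^ (-β)) ^ k) P ∧
      ∫ ω, (Y ω ^ (-β)) ^ k ∂P = k.factorial / Real.Gamma (1 + β * k) := by
  rcases Nat.eq_zero_or_pos k with rfl | hk
  · simp
  have hk' : (0 : ℝ) < k := by exact_mod_cast hk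
  have hm := hY.measurable
  have h := hY.lintegral_rpow_neg hβ (p := β * k) (by positivity)
  have hfin : ∫⁻ ω, ENNReal.ofReal ((Y ω ^ (-β)) ^ k) ∂P =
      ENNReal.ofReal (k.factorial / Real.Gamma (1 + β * k)) := by
    have e : (k.factorial : ℝ) / Real.Gamma (1 + β * k) =
        Real.Gamma (β * k / β) / (β * Real.Gamma (β * k)) := by
      have h1 : Real.Gamma (1 + β * k) = β * k * Real.Gamma (β * k) := by
        rw [add_comm, Real.Gamma_add_one (by positivity)]
      have h2 : (k.factorial : ℝ) = k * Real.Gamma k := by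
        rw [← Real.Gamma_nat_eq_factorial, Real.Gamma_add_one hk'.ne']
      have hΓ : 0 < Real.Gamma (β * k) := Real.Gamma_pos_of_pos (by positivity)
      rw [h1, h2, mul_div_cancel_left₀ _ hβ.ne']
      field_simp
    rw [e, ← h]
    refine lintegral_congr_ae ?_
    filter_upwards [hY.nonneg] with ω hω
    rw [← Real.rpow_natCast, ← Real.rpow_mul hω, neg_mul]
  have hnn : 0 ≤ᵐ[P] fun ω => (Y ω ^ (-β)) ^ k := by
    filter_upwards [hY.nonneg] with ω hω
    exact pow_nonneg (Real.rpow_nonneg hω _) _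
  have hmeas : AEStronglyMeasurable (fun ω => (Y ω ^ (-β)) ^ k) P :=
    ((hm.pow_const _).pow_const _).aestronglyMeasurable
  refine ⟨⟨hmeas, ?_⟩, ?_⟩
  · rw [hasFiniteIntegral_iff_ofReal hnn, hfin]
    exact ENNReal.ofReal_lt_top
  · rw [integral_eq_lintegral_of_nonneg_ae hnn hmeas, hfin, ENNReal.toReal_ofReal]
    have : 0 < Real.Gamma (1 + β * k) := Real.Gamma_pos_of_pos (by positivity)
    positivity

/-- `E_β(-z)` is the Laplace transform of `Y^{-β}`: the moments of `Y^{-β}` are `k! / Γ(1 + β k)`,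
and the exponential series may be integrated term by term. -/
theorem mittagLeffler_neg (hY : IsPositiveStable β Y P) (hβ : 0 < β) {z : ℝ} (hz : 0 ≤ z) :
    mittagLeffler β (-z) = ∫ ω, Real.exp (-(z * Y ω ^ (-β))) ∂P := by
  have hmom := hY.integrable_and_integral_pow hβ
  set F : ℕ → Ω → ℝ := fun k ω => (-z) ^ k / k.factorial * (Y ω ^ (-β)) ^ k with hF
  have hFint : ∀ k, Integrable (F k) P := fun k => (hmom k).1.const_mul _
  have hFval : ∀ k, ∫ ω, F k ω ∂P = (-z) ^ k / Real.Gamma (1 + β * k) := by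
    intro k
    simp only [hF]
    rw [integral_const_mul, (hmom k).2]
    have : (k.factorial : ℝ) ≠ 0 := by positivity
    field_simp
  have hFnorm : ∀ k, ∫ ω, ‖F k ω‖ ∂P = z ^ k / Real.Gamma (1 + β * k) := by
    intro k
    have : ∀ᵐ ω ∂P, ‖F k ω‖ = z ^ k / k.factorial * (Y ω ^ (-β)) ^ k := by
      filter_upwards [hY.nonneg] with ω hω
      have h0 : 0 ≤ Y ω ^ (-β) := Real.rpow_nonneg hω _
      rw [hF]
      simp [abs_of_nonneg hz, abs_of_nonneg h0]
    rw [integral_congr_ae this, integral_const_mul, (hmom k).2]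
    have : (k.factorial : ℝ) ≠ 0 := by positivity
    field_simp
  have h := hasSum_integral_of_summable_integral_norm hFint
    (by simpa only [hFnorm] using summable_pow_div_Gamma hβ hz)
  simp only [hFval] at h
  rw [mittagLeffler, h.tsum_eq]
  refine integral_congr_ae (Eventually.of_forall fun ω => ?_)
  simp only [hF]
  rw [Real.exp_eq_exp_ℝ, NormedSpace.exp_eq_tsum_div]
  refine tsum_congr fun k => ?_
  rw [← neg_mul, mul_pow]
  ring

end IsPositiveStable

/-! ### Two-sided bounds for `E_β(-z)` and the integrability criterion -/

theorem mul_exp_neg_le_one_sub_exp_neg (x : ℝ) : x * Real.exp (-x) ≤ 1 - Real.exp (-x) := by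
  have h1 := Real.add_one_le_exp x
  have h2 : Real.exp x * Real.exp (-x) = 1 := by rw [← Real.exp_add]; simp
  nlinarith [Real.exp_pos (-x)]

theorem exists_exp_neg_rpow_neg_le {β : ℝ} (hβ : 0 < β) :
    ∃ C : ℝ, 0 < C ∧ ∀ x : ℝ, 0 < x → Real.exp (-x ^ (-β)) ≤ C * (1 - Real.exp (-x)) := by
  set n : ℕ := ⌈1 / β⌉₊ with hn
  have hnβ : 1 ≤ β * n := by
    have := Nat.le_ceil (1 / β)
    rw [div_le_iff₀ hβ] at this
    linarith
  have hfac : (1 : ℝ) ≤ n.factorial := by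
    exact_mod_cast Nat.one_le_iff_ne_zero.2 n.factorial_ne_zero
  have he : Real.exp 1 * Real.exp (-1) = 1 := by rw [← Real.exp_add]; simp
  have he2 : 2 ≤ Real.exp 1 := by linarith [Real.add_one_le_exp (1 : ℝ)]
  refine ⟨n.factorial * Real.exp 1, by positivity, fun x hx => ?_⟩
  rcases le_total 1 x with h1 | h1
  · have hx1 : Real.exp (-x) ≤ Real.exp (-1) := Real.exp_le_exp.2 (by linarith)
    have hx2 : 1 ≤ Real.exp 1 * (1 - Real.exp (-x)) := by nlinarith
    calc Real.exp (-x ^ (-β)) ≤ 1 := by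
          rw [Real.exp_le_one_iff, neg_nonpos]
          positivity
      _ ≤ n.factorial * (Real.exp 1 * (1 - Real.exp (-x))) :=
          one_le_mul_of_one_le_of_one_le hfac hx2
      _ = _ := by ring
  · have hw : 0 < x ^ (-β) := by positivity
    have hpow := Real.pow_div_factorial_le_exp (x ^ (-β)) hw.le n
    rw [← Real.rpow_natCast, ← Real.rpow_mul hx.le, div_le_iff₀ (by positivity)] at hpow
    have hxn : x ^ (-(-β * n)) ≤ x := by
      have := Real.rpow_le_rpow_of_exponent_ge hx h1 hnβ
      rw [Real.rpow_one] at this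
      simpa using this
    have hA : Real.exp (-x ^ (-β)) ≤ n.factorial * x := by
      rw [Real.exp_neg, inv_le_iff_one_le_mul₀ (Real.exp_pos _)]
      have h2 : x ^ (-(-β * n)) * x ^ (-β * n) = 1 := by
        rw [← Real.rpow_add hx]; simp
      have h3 : 0 < x ^ (-β * n) := by positivity
      nlinarith
    have hB : x ≤ Real.exp 1 * (1 - Real.exp (-x)) := by
      have h2 := mul_exp_neg_le_one_sub_exp_neg x
      have h3 : Real.exp (-1) ≤ Real.exp (-x) := Real.exp_le_exp.2 (by linarith)
      nlinarith [Real.exp_pos 1]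
    calc Real.exp (-x ^ (-β)) ≤ n.factorial * x := hA
      _ ≤ n.factorial * (Real.exp 1 * (1 - Real.exp (-x))) := by gcongr
      _ = _ := by ring

namespace IsPositiveStable

variable {Ω : Type*} [MeasurableSpace Ω] {β : ℝ} {Y : Ω → ℝ} {P : Measure Ω}
  [IsProbabilityMeasure P]

theorem integrable_exp_neg (hY : IsPositiveStable β Y P) {l : ℝ} (hl : 0 ≤ l) :
    Integrable (fun ω => Real.exp (-(l * Y ω))) P := by
  simpa using integrable_exp_mul_of_nonpos hY.measurable.aemeasurable hY.nonneg
    (t := -l) (by linarith)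

theorem integral_one_sub_exp_neg (hY : IsPositiveStable β Y P) {l : ℝ} (hl : 0 < l) :
    ∫ ω, (1 - Real.exp (-(l * Y ω))) ∂P = 1 - Real.exp (-l ^ β) := by
  rw [integral_sub (integrable_const _) (hY.integrable_exp_neg hl.le), hY.laplace_eq l hl]
  simp

theorem integrable_exp_neg_rpow (hY : IsPositiveStable β Y P) {z : ℝ} (hz : 0 ≤ z) :
    Integrable (fun ω => Real.exp (-(z * Y ω ^ (-β)))) P := by
  have := integrable_exp_mul_of_nonpos (P := P) (A := fun ω => Y ω ^ (-β))
    (hY.measurable.pow_const _).aemeasurable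
    (hY.nonneg.mono fun ω hω => Real.rpow_nonneg hω _) (t := -z) (by linarith)
  simpa using this

theorem mittagLeffler_neg_nonneg (hY : IsPositiveStable β Y P) (hβ : 0 < β) {z : ℝ}
    (hz : 0 ≤ z) : 0 ≤ mittagLeffler β (-z) := by
  rw [hY.mittagLeffler_neg hβ hz]
  exact integral_nonneg fun ω => (Real.exp_pos _).le

theorem mittagLeffler_neg_le_one (hY : IsPositiveStable β Y P) (hβ : 0 < β) {z : ℝ}
    (hz : 0 ≤ z) : mittagLeffler β (-z) ≤ 1 := by
  rw [hY.mittagLeffler_neg hβ hz]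
  calc ∫ ω, Real.exp (-(z * Y ω ^ (-β))) ∂P ≤ ∫ _, (1 : ℝ) ∂P := by
        refine integral_mono_ae (hY.integrable_exp_neg_rpow hz) (integrable_const _) ?_
        filter_upwards [hY.nonneg] with ω hω
        rw [Real.exp_le_one_iff, neg_nonpos]
        positivity
    _ = 1 := by simp

/-- With `s = z^{-1/β}`, one has `z Y^{-β} = (s Y)^{-β}`, so that the bound
`exp(-x^{-β}) ≤ C (1 - exp(-x))` compares `E_β(-z)` with `1 - exp(-s^β) ≤ 1 / z`. -/
theorem exists_mittagLeffler_neg_le (hY : IsPositiveStable β Y P) (hβ : 0 < β) :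
    ∃ C : ℝ, 0 < C ∧ ∀ z : ℝ, 0 < z → mittagLeffler β (-z) ≤ C / z := by
  obtain ⟨C, hC, hle⟩ := exists_exp_neg_rpow_neg_le hβ
  refine ⟨C, hC, fun z hz => ?_⟩
  set s : ℝ := z ^ (-(1 / β)) with hs
  have hs0 : 0 < s := by positivity
  have hsβ : s ^ β = z⁻¹ := by
    rw [hs, ← Real.rpow_mul hz.le, neg_mul, one_div_mul_cancel hβ.ne', Real.rpow_neg_one]
  have hsnβ : s ^ (-β) = z := by rw [Real.rpow_neg hs0.le, hsβ, inv_inv]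
  rw [hY.mittagLeffler_neg hβ hz.le]
  calc ∫ ω, Real.exp (-(z * Y ω ^ (-β))) ∂P
      ≤ ∫ ω, C * (1 - Real.exp (-(s * Y ω))) ∂P := by
        refine integral_mono_ae (hY.integrable_exp_neg_rpow hz.le)
          (((integrable_const _).sub (hY.integrable_exp_neg hs0.le)).const_mul _) ?_
        filter_upwards [hY.pos hβ] with ω hω
        have := hle (s * Y ω) (by positivity)
        rwa [Real.mul_rpow hs0.le hω.le, hsnβ] at this
    _ = C * (1 - Real.exp (-s ^ β)) := by
        rw [integral_const_mul, hY.integral_one_sub_exp_neg hs0]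
    _ ≤ C * z⁻¹ := by
        gcongr
        rw [hsβ]
        linarith [Real.add_one_le_exp (-z⁻¹)]
    _ = C / z := rfl

/-- Split `1 - exp(-sY)` according to whether `Y ≥ y := z^{1/β}`. On `{Y ≥ y}` the integrand
`exp(-z Y^{-β})` is at least `e⁻¹`; on the complement
`s Y ≤ e s Y exp(-Y/y) ≤ e s y (1 - exp(-Y/y))`. For `s = δ / y` with `δ` small, the second
contribution is absorbed by `1 - exp(-s^β)`. -/
theorem exists_le_mittagLeffler_neg (hY : IsPositiveStable β Y P) (hβ : 0 < β) (hβ1 : β < 1) :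
    ∃ c : ℝ, 0 < c ∧ ∀ z : ℝ, 1 ≤ z → c / z ≤ mittagLeffler β (-z) := by
  set e : ℝ := Real.exp 1 with he
  have he1 : 1 ≤ e := Real.one_le_exp zero_le_one
  -- `δ` solves `δ e = δ ^ β / (2 e)`.
  set δ : ℝ := (2 * e ^ 2) ^ (-(1 / (1 - β))) with hδ
  have hδ0 : 0 < δ := by positivity
  have hδ1 : δ ≤ 1 := by
    refine Real.rpow_le_one_of_one_le_of_nonpos (by nlinarith) ?_
    rw [neg_nonpos]
    exact div_nonneg zero_le_one (by linarith)
  have hδβ : δ * (2 * e ^ 2) = δ ^ β := by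
    have h1 : δ ^ (1 - β) = (2 * e ^ 2)⁻¹ := by
      rw [hδ, ← Real.rpow_mul (by positivity), neg_mul,
        one_div_mul_cancel (by linarith : (1 - β) ≠ 0), Real.rpow_neg_one]
    have h2 : δ = δ ^ β * δ ^ (1 - β) := by rw [← Real.rpow_add hδ0]; simp
    rw [h1] at h2
    rw [eq_mul_inv_iff_mul_eq₀ (by positivity)] at h2
    exact h2
  refine ⟨δ, hδ0, fun z hz => ?_⟩
  have hz0 : 0 < z := by linarith
  set y : ℝ := z ^ (1 / β) with hy
  have hy0 : 0 < y := by positivity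
  have hyβ : y ^ β = z := by
    rw [hy, ← Real.rpow_mul hz0.le, one_div_mul_cancel hβ.ne', Real.rpow_one]
  have hpt : ∀ᵐ ω ∂P, 1 - Real.exp (-(δ / y * Y ω)) ≤
      e * Real.exp (-(z * Y ω ^ (-β))) + δ * e * (1 - Real.exp (-(y⁻¹ * Y ω))) := by
    filter_upwards [hY.pos hβ] with ω hω
    have hnn : 0 ≤ 1 - Real.exp (-(y⁻¹ * Y ω)) := by
      rw [sub_nonneg, Real.exp_le_one_iff, neg_nonpos]
      positivity
    rcases le_total y (Y ω) with h | h
    · have h1 : z * Y ω ^ (-β) ≤ 1 := by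
        rw [Real.rpow_neg hω.le, ← hyβ, ← div_eq_mul_inv, div_le_one (by positivity)]
        gcongr
      have h2 : 1 ≤ e * Real.exp (-(z * Y ω ^ (-β))) := by
        rw [he, ← Real.exp_add, Real.one_le_exp_iff]
        linarith
      have h3 : 0 ≤ δ * e * (1 - Real.exp (-(y⁻¹ * Y ω))) := by positivity
      linarith [Real.exp_pos (-(δ / y * Y ω))]
    · have h1 : y⁻¹ * Y ω ≤ 1 := by rw [inv_mul_le_iff₀ hy0]; linarith
      have h2 : 1 ≤ e * Real.exp (-(y⁻¹ * Y ω)) := by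
        rw [he, ← Real.exp_add, Real.one_le_exp_iff]
        linarith
      have h3 := mul_exp_neg_le_one_sub_exp_neg (y⁻¹ * Y ω)
      have h4 : 0 ≤ e * Real.exp (-(z * Y ω ^ (-β))) := by positivity
      calc 1 - Real.exp (-(δ / y * Y ω)) ≤ δ / y * Y ω := by
            linarith [Real.add_one_le_exp (-(δ / y * Y ω))]
        _ = δ * (y⁻¹ * Y ω) * 1 := by ring
        _ ≤ δ * (y⁻¹ * Y ω) * (e * Real.exp (-(y⁻¹ * Y ω))) := by gcongr
        _ = δ * e * (y⁻¹ * Y ω * Real.exp (-(y⁻¹ * Y ω))) := by ring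
        _ ≤ δ * e * (1 - Real.exp (-(y⁻¹ * Y ω))) := by gcongr
        _ ≤ _ := by linarith
  have hi1 := (hY.integrable_exp_neg_rpow hz0.le).const_mul e
  have hi2 := ((integrable_const (1 : ℝ)).sub
    (hY.integrable_exp_neg (inv_pos.2 hy0).le)).const_mul (δ * e)
  have hint := integral_mono_ae ((integrable_const (1 : ℝ)).sub
    (hY.integrable_exp_neg (by positivity : 0 ≤ δ / y))) (hi1.add hi2) hpt
  rw [Pi.sub_def, Pi.add_def, integral_add hi1 hi2, integral_const_mul, integral_const_mul,
    hY.integral_one_sub_exp_neg (by positivity), Pi.sub_def,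
    hY.integral_one_sub_exp_neg (by positivity), ← hY.mittagLeffler_neg hβ hz0.le,
    Real.div_rpow hδ0.le hy0.le, Real.inv_rpow hy0.le, hyβ] at hint
  have hup : 1 - Real.exp (-z⁻¹) ≤ z⁻¹ := by linarith [Real.add_one_le_exp (-z⁻¹)]
  have hlow : δ ^ β / z * e⁻¹ ≤ 1 - Real.exp (-(δ ^ β / z)) := by
    refine le_trans ?_ (mul_exp_neg_le_one_sub_exp_neg _)
    rw [he, ← Real.exp_neg]
    have h1 : δ ^ β / z ≤ 1 := by
      rw [div_le_one hz0]
      exact (Real.rpow_le_one hδ0.le hδ1 hβ.le).trans hz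
    gcongr
  have h5 : δ * e * (1 - Real.exp (-z⁻¹)) ≤ δ * e * z⁻¹ := by gcongr
  have h6 : δ ^ β / z * e⁻¹ = 2 * (δ * e * z⁻¹) := by
    rw [← hδβ]
    field_simp
  have h7 : e * (δ / z) ≤ e * mittagLeffler β (-z) := by
    have : e * (δ / z) = δ * e * z⁻¹ := by ring
    linarith
  exact le_of_mul_le_mul_left h7 (by positivity)

theorem aestronglyMeasurable_mittagLeffler_neg (hY : IsPositiveStable β Y P) (hβ : 0 < β) :
    AEStronglyMeasurable (fun z => mittagLeffler β (-z)) (volume.restrict (Ioi 0)) := by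
  have hm := hY.measurable
  have hmeas : StronglyMeasurable
      (Function.uncurry fun (z : ℝ) (ω : Ω) => Real.exp (-(z * Y ω ^ (-β)))) := by
    refine Measurable.stronglyMeasurable ?_
    unfold Function.uncurry
    fun_prop
  refine (hmeas.integral_prod_right (ν := P)).aestronglyMeasurable.congr ?_
  filter_upwards [ae_restrict_mem measurableSet_Ioi] with z hz
  exact (hY.mittagLeffler_neg hβ (le_of_lt hz)).symm

/-- As `E_β(-z)` is bounded near `0` and of exact order `1 / z` at infinity, the integrand behaves
like `z^{a-3}` at infinity. -/
theorem integrableOn_rpow_mul_mittagLeffler_sq_iff (hY : IsPositiveStable β Y P)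
    (hβ : 0 < β) (hβ1 : β < 1) {a : ℝ} (ha : 0 < a) :
    IntegrableOn (fun z : ℝ => z ^ (a - 1) * mittagLeffler β (-z) ^ 2) (Ioi 0) ↔ a < 2 := by
  have hmeas : AEStronglyMeasurable (fun z : ℝ => z ^ (a - 1) * mittagLeffler β (-z) ^ 2)
      (volume.restrict (Ioi 0)) :=
    (by fun_prop : Measurable fun z : ℝ => z ^ (a - 1)).aestronglyMeasurable.mul
      ((hY.aestronglyMeasurable_mittagLeffler_neg hβ).pow 2)
  have hexp : ∀ (b z : ℝ), 0 < z → z ^ (a - 1) * (b / z) ^ 2 = b ^ 2 * z ^ (a - 3) := by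
    intro b z hz
    have : z ^ (a - 1) = z ^ (a - 3) * z ^ 2 := by
      rw [← Real.rpow_natCast, ← Real.rpow_add hz]
      norm_num
      ring_nf
    rw [this]
    field_simp
  constructor
  · intro h
    obtain ⟨c, hc, hle⟩ := hY.exists_le_mittagLeffler_neg hβ hβ1
    have h1 : IntegrableOn (fun z : ℝ => c ^ 2 * z ^ (a - 3)) (Ioi 1) := by
      refine Integrable.mono' (h.mono_set (Ioi_subset_Ioi zero_le_one))
        (by fun_prop : Measurable fun z : ℝ => c ^ 2 * z ^ (a - 3)).aestronglyMeasurable ?_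
      filter_upwards [ae_restrict_mem measurableSet_Ioi] with z hz
      have hz1 : (1 : ℝ) < z := hz
      have hz0 : (0 : ℝ) < z := by linarith
      have := hle z hz1.le
      rw [Real.norm_of_nonneg (by positivity), ← hexp c z hz0]
      gcongr
    have h2 : IntegrableOn (fun z : ℝ => z ^ (a - 3)) (Ioi 1) := by
      have := h1.const_mul ((c ^ 2)⁻¹)
      refine this.congr (Eventually.of_forall fun z => ?_)
      simp only
      field_simp
    have h3 := (integrableOn_Ioi_rpow_iff zero_lt_one).1 h2
    linarith
  · intro h
    obtain ⟨C, hC, hle⟩ := hY.exists_mittagLeffler_neg_le hβ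
    rw [← Ioc_union_Ioi_eq_Ioi (zero_le_one' ℝ)]
    refine IntegrableOn.union ?_ ?_
    · have h1 : IntegrableOn (fun z : ℝ => z ^ (a - 1)) (Ioc 0 1) := by
        have := intervalIntegral.intervalIntegrable_rpow' (a := 0) (b := 1) (r := a - 1)
          (by linarith)
        rwa [intervalIntegrable_iff_integrableOn_Ioc_of_le zero_le_one] at this
      refine Integrable.mono' h1 (hmeas.mono_set Ioc_subset_Ioi_self) ?_
      filter_upwards [ae_restrict_mem measurableSet_Ioc] with z hz
      have hz0 : (0 : ℝ) < z := hz.1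
      have h2 := hY.mittagLeffler_neg_nonneg hβ hz0.le
      have h3 := hY.mittagLeffler_neg_le_one hβ hz0.le
      rw [Real.norm_of_nonneg (by positivity)]
      exact mul_le_of_le_one_right (by positivity) (pow_le_one₀ h2 h3)
    · have h1 : IntegrableOn (fun z : ℝ => C ^ 2 * z ^ (a - 3)) (Ioi 1) :=
        ((integrableOn_Ioi_rpow_iff zero_lt_one).2 (by linarith)).const_mul _
      refine Integrable.mono' h1 (hmeas.mono_set (Ioi_subset_Ioi zero_le_one)) ?_
      filter_upwards [ae_restrict_mem measurableSet_Ioi] with z hz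
      have hz1 : (1 : ℝ) < z := hz
      have hz0 : (0 : ℝ) < z := by linarith
      have h2 := hY.mittagLeffler_neg_nonneg hβ hz0.le
      have := hle z hz0
      rw [Real.norm_of_nonneg (by positivity), ← hexp C z hz0]
      gcongr

end IsPositiveStable

/-! ### Plancherel's theorem for finite measures -/

section Plancherel

open scoped FourierTransform SchwartzMap ContDiff
open Metric Function

variable {E : Type*} [NormedAddCommGroup E] [InnerProductSpace ℝ E] [FiniteDimensional ℝ E]

theorem exists_schwartz_tendsto_indicator {K : Set E} (hK : IsCompact K) :
    ∃ (g : ℕ → 𝓢(E, ℂ)) (K' : Set E), IsCompact K' ∧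
      (∀ n x, ‖g n x‖ ≤ K'.indicator (fun _ => (1 : ℝ)) x) ∧
      ∀ x, Tendsto (fun n => g n x) atTop (𝓝 (K.indicator (fun _ => (1 : ℂ)) x)) := by
  obtain ⟨δ, δpos, hδ⟩ : ∃ δ, 0 < δ ∧ IsCompact (cthickening δ K) :=
    hK.exists_isCompact_cthickening
  obtain ⟨u, -, u_pos, u_lim⟩ : ∃ u, StrictAnti u ∧ (∀ n : ℕ, u n ∈ Ioo 0 δ) ∧
    Tendsto u atTop (𝓝 0) := exists_seq_strictAnti_tendsto' δpos
  have hv : ∀ n, thickening (u n) K ⊆ cthickening δ K :=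
    fun n => thickening_subset_cthickening_of_le (u_pos n).2.le _
  have : ∀ n, ∃ g : E → ℝ, support g = thickening (u n) K ∧ ContDiff ℝ ∞ g ∧
      Set.range g ⊆ Set.Icc 0 1 ∧ ∀ x ∈ K, g x = 1 := by
    intro n
    rcases exists_contMDiff_support_eq_eq_one_iff (modelWithCornersSelf ℝ E) isOpen_thickening
      hK.isClosed (self_subset_thickening (u_pos n).1 K) with ⟨g, g_smooth, g_range, g_supp, hg⟩
    exact ⟨g, g_supp, g_smooth.contDiff, g_range, fun x hx => (hg x).1 hx⟩
  choose g g_supp g_diff g_range hg using this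
  have hcs : ∀ n, HasCompactSupport fun x => (g n x : ℂ) := fun n =>
    HasCompactSupport.intro hδ fun x hx => by
      have : x ∉ support (g n) := by rw [g_supp]; exact fun h => hx (hv n h)
      simpa using this
  have hcd : ∀ n, ContDiff ℝ ∞ fun x => (g n x : ℂ) := fun n =>
    Complex.ofRealCLM.contDiff.comp (g_diff n)
  refine ⟨fun n => (hcs n).toSchwartzMap (hcd n), cthickening δ K, hδ, fun n x => ?_, fun x => ?_⟩
  · show ‖(g n x : ℂ)‖ ≤ _
    refine le_indicator_apply (fun _ => ?_) (fun hx => ?_)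
    · have := g_range n (mem_range_self x)
      rw [Complex.norm_real, Real.norm_of_nonneg this.1]
      exact this.2
    · have : x ∉ support (g n) := by rw [g_supp]; exact fun h => hx (hv n h)
      simp [notMem_support.1 this]
  · show Tendsto (fun n => (g n x : ℂ)) _ _
    by_cases hx : x ∈ K
    · simp [hg _ x hx, hx]
    · rw [indicator_of_notMem hx]
      apply tendsto_const_nhds.congr'
      obtain ⟨ε, εpos, hε⟩ : ∃ ε, 0 < ε ∧ x ∉ thickening ε K := by
        rw [← hK.isClosed.closure_eq, closure_eq_iInter_thickening K] at hx
        simpa using hx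
      filter_upwards [(tendsto_order.1 u_lim).2 _ εpos] with n hn
      have : x ∉ support (g n) := by
        rw [g_supp]
        exact fun h => hε (thickening_mono hn.le K h)
      simp [notMem_support.1 this]

variable [MeasurableSpace E] [BorelSpace E]

/-- If `f μ` and `h ν` agree as functionals on Schwartz functions, they agree on compact sets, whose
indicator functions are boundedly approximated by smooth functions with compact support. -/
theorem setIntegral_eq_of_forall_schwartz {μ ν : Measure E} {f h : E → ℂ}
    (hf : LocallyIntegrable f μ) (hh : LocallyIntegrable h ν)
    (H : ∀ g : 𝓢(E, ℂ), ∫ x, g x • f x ∂μ = ∫ x, g x • h x ∂ν) {K : Set E} (hK : IsCompact K) :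
    ∫ x in K, f x ∂μ = ∫ x in K, h x ∂ν := by
  obtain ⟨g, K', hK', hle, hlim⟩ := exists_schwartz_tendsto_indicator hK
  have key : ∀ {m : Measure E} {φ : E → ℂ}, LocallyIntegrable φ m →
      Tendsto (fun n => ∫ x, g n x • φ x ∂m) atTop (𝓝 (∫ x in K, φ x ∂m)) := by
    intro m φ hφ
    rw [← integral_indicator hK.measurableSet]
    refine tendsto_integral_of_dominated_convergence (K'.indicator fun x => ‖φ x‖)
      (fun n => (g n).continuous.aestronglyMeasurable.smul hφ.aestronglyMeasurable)
      ((integrable_indicator_iff hK'.measurableSet).2 (hφ.integrableOn_isCompact hK').norm)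
      (fun n => Eventually.of_forall fun x => ?_) (Eventually.of_forall fun x => ?_)
    · rw [norm_smul]
      refine (mul_le_mul_of_nonneg_right (hle n x) (norm_nonneg _)).trans_eq ?_
      by_cases hx : x ∈ K' <;> simp [hx]
    · have := (hlim x).smul_const (φ x)
      by_cases hx : x ∈ K <;> simpa [hx] using this
  refine tendsto_nhds_unique (key hf) ?_
  simpa only [H] using key hh

/-- Parseval's relation between a finite measure and its characteristic function. -/
theorem integral_fourier_mul_charFun {μ : Measure E} [IsFiniteMeasure μ] (g : 𝓢(E, ℂ)) :
    ∫ ξ, 𝓕 g ξ • charFun μ ((2 * Real.pi) • ξ) = ∫ x, g x ∂μ := by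
  have hint : Integrable (uncurry fun (ξ : E) (x : E) =>
      𝓕 g ξ * Complex.exp (inner ℝ x ((2 * Real.pi) • ξ) * Complex.I)) (volume.prod μ) := by
    have h1 : Integrable (fun p : E × E => 𝓕 g p.1) (volume.prod μ) :=
      (𝓕 g).integrable.comp_fst μ
    refine h1.mono ?_ (Eventually.of_forall fun p => ?_)
    · refine Continuous.aestronglyMeasurable ?_
      have := (𝓕 g).continuous
      unfold uncurry
      fun_prop
    · simp [uncurry, Complex.norm_exp]
  calc ∫ ξ, 𝓕 g ξ • charFun μ ((2 * Real.pi) • ξ)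
      = ∫ ξ, ∫ x, 𝓕 g ξ * Complex.exp (inner ℝ x ((2 * Real.pi) • ξ) * Complex.I) ∂μ := by
        simp only [charFun_apply, smul_eq_mul, integral_const_mul]
    _ = ∫ x, (∫ ξ, 𝓕 g ξ * Complex.exp (inner ℝ x ((2 * Real.pi) • ξ) * Complex.I)) ∂μ :=
        integral_integral_swap hint
    _ = ∫ x, g x ∂μ := by
        refine integral_congr_ae (Eventually.of_forall fun x => ?_)
        have h1 : g x = 𝓕⁻ (𝓕 g) x := by rw [FourierTransform.fourierInv_fourier_eq]
        simp only
        rw [h1, SchwartzMap.fourierInv_coe, Real.fourierInv_eq']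
        refine integral_congr_ae (Eventually.of_forall fun ξ => ?_)
        simp only [smul_eq_mul]
        rw [mul_comm, inner_smul_right, real_inner_comm]

/-- A finite measure with square integrable characteristic function has a square integrable
density, whose `L²` norm is given by Plancherel's formula. The Fourier transform `F ∈ L²` of
`ξ ↦ charFun μ (2 π ξ)` satisfies `μ K = ∫_K F` for compact `K`; hence `μ` is absolutely
continuous and `F` is its density. -/
theorem absolutelyContinuous_and_integral_rnDeriv_sq {μ : Measure E} [IsFiniteMeasure μ]
    (hμ : MemLp (fun ξ => charFun μ ((2 * Real.pi) • ξ)) 2 volume) :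
    μ ≪ volume ∧ MemLp (fun x => (μ.rnDeriv volume x).toReal) 2 volume ∧
      ∫ x, (μ.rnDeriv volume x).toReal ^ 2 = ∫ ξ, ‖charFun μ ((2 * Real.pi) • ξ)‖ ^ 2 := by
  set f : Lp ℂ 2 (volume : Measure E) := hμ.toLp _ with hf
  set F : Lp ℂ 2 (volume : Measure E) := 𝓕 f with hF
  have hFloc : LocallyIntegrable F (volume : Measure E) :=
    (Lp.memLp F).locallyIntegrable one_le_two
  have hSch : ∀ g : 𝓢(E, ℂ), ∫ x, g x • (1 : ℂ) ∂μ = ∫ x, g x • F x := by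
    intro g
    have h1 := congrArg (fun T => T g) (Lp.fourier_toTemperedDistribution_eq f)
    simp only [TemperedDistribution.fourier_apply, Lp.toTemperedDistribution_apply] at h1
    rw [hF, ← h1]
    simp only [smul_eq_mul, mul_one]
    rw [← integral_fourier_mul_charFun g]
    refine integral_congr_ae ?_
    filter_upwards [hμ.coeFn_toLp] with ξ hξ
    rw [hf, hξ, smul_eq_mul]
  have hcomp : ∀ K : Set E, IsCompact K → ((μ.real K : ℝ) : ℂ) = ∫ x in K, F x := by
    intro K hK
    rw [← setIntegral_eq_of_forall_schwartz (locallyIntegrable_const 1) hFloc hSch hK]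
    simp
  have hac : μ ≪ volume := by
    refine Measure.AbsolutelyContinuous.mk fun s hs hs0 => ?_
    rw [hs.measure_eq_iSup_isCompact]
    simp only [ENNReal.iSup_eq_zero]
    intro K hKs hK
    have h0 : volume.restrict K = (0 : Measure E) :=
      Measure.restrict_eq_zero.2 (measure_mono_null hKs hs0)
    have := hcomp K hK
    rw [h0, integral_zero_measure, Complex.ofReal_eq_zero, measureReal_eq_zero_iff] at this
    exact this
  have hdens : (fun x => ((μ.rnDeriv volume x).toReal : ℂ)) =ᵐ[volume] F := by
    have hint : Integrable (fun x => ((μ.rnDeriv volume x).toReal : ℂ)) volume :=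
      (Measure.integrable_toReal_rnDeriv (μ := μ) (ν := volume)).ofReal
    have h0 := ae_eq_zero_of_forall_setIntegral_isCompact_eq_zero'
      (hint.locallyIntegrable.sub hFloc) (fun K hK => by
        simp only [Pi.sub_apply]
        rw [integral_sub hint.integrableOn (hFloc.integrableOn_isCompact hK), ← hcomp K hK,
          integral_complex_ofReal, Measure.setIntegral_toReal_rnDeriv hac, sub_self])
    filter_upwards [h0] with x hx
    exact sub_eq_zero.1 hx
  have hmemC : MemLp (fun x => ((μ.rnDeriv volume x).toReal : ℂ)) 2 volume :=
    (memLp_congr_ae hdens).2 (Lp.memLp F)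
  have hmem : MemLp (fun x => (μ.rnDeriv volume x).toReal) 2 volume := by
    simpa using hmemC.re
  have hnorm : ∀ G : Lp ℂ 2 (volume : Measure E), ‖G‖ ^ 2 = ∫ x, ‖G x‖ ^ 2 := by
    intro G
    have h1 := L2.inner_def (𝕜 := ℂ) G G
    rw [inner_self_eq_norm_sq_to_K] at h1
    have h2 : ∀ x, inner ℂ (G x) (G x) = ((‖G x‖ ^ 2 : ℝ) : ℂ) := by
      intro x
      rw [inner_self_eq_norm_sq_to_K]
      simp
    simp only [h2] at h1
    rw [integral_complex_ofReal] at h1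
    apply Complex.ofReal_injective
    rw [← h1]
    simp
  refine ⟨hac, hmem, ?_⟩
  calc ∫ x, (μ.rnDeriv volume x).toReal ^ 2 = ∫ x, ‖F x‖ ^ 2 := by
        refine integral_congr_ae ?_
        filter_upwards [hdens] with x hx
        rw [← hx, Complex.norm_real, Real.norm_eq_abs, sq_abs]
    _ = ‖F‖ ^ 2 := (hnorm F).symm
    _ = ‖f‖ ^ 2 := by rw [hF, Lp.norm_fourier_eq]
    _ = ∫ ξ, ‖charFun μ ((2 * Real.pi) • ξ)‖ ^ 2 := by
        rw [hnorm]
        refine integral_congr_ae ?_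
        filter_upwards [hμ.coeFn_toLp] with ξ hξ
        rw [hf, hξ]

end Plancherel

/-! ### Evaluation of a process at an independent random time -/

section RandomTime

/-- The grid point `(⌊(n+1) u⌋ + 1) / (n + 1)`, which lies strictly to the right of `u` and tends to
`u`. -/
noncomputable def gridAbove (n : ℕ) (u : ℝ≥0) : ℝ≥0 :=
  ((⌊((n : ℝ≥0) + 1) * u⌋₊ : ℝ≥0) + 1) / ((n : ℝ≥0) + 1)

theorem le_gridAbove (n : ℕ) (u : ℝ≥0) : u ≤ gridAbove n u := by
  rw [gridAbove, le_div_iff₀ (by positivity), mul_comm]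
  exact (Nat.lt_floor_add_one _).le

theorem gridAbove_le (n : ℕ) (u : ℝ≥0) : gridAbove n u ≤ u + 1 / ((n : ℝ≥0) + 1) := by
  have h : (u + 1 / ((n : ℝ≥0) + 1)) * ((n : ℝ≥0) + 1) = ((n : ℝ≥0) + 1) * u + 1 := by
    rw [add_mul, div_mul_cancel₀ _ (by positivity), mul_comm u]
  rw [gridAbove, div_le_iff₀ (by positivity), h]
  gcongr
  exact Nat.floor_le (by positivity)

theorem tendsto_gridAbove (u : ℝ≥0) : Tendsto (fun n => gridAbove n u) atTop (𝓝[≥] u) := by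
  refine tendsto_nhdsWithin_iff.2 ⟨?_, Eventually.of_forall fun n => le_gridAbove n u⟩
  refine tendsto_of_tendsto_of_tendsto_of_le_of_le tendsto_const_nhds ?_
    (fun n => le_gridAbove n u) (fun n => gridAbove_le n u)
  have h : Tendsto (fun n : ℕ => 1 / ((n : ℝ≥0) + 1)) atTop (𝓝 0) :=
    tendsto_one_div_add_atTop_nhds_zero_nat
  simpa using h.const_add u

theorem measurable_gridAbove (n : ℕ) : Measurable (gridAbove n) := by
  unfold gridAbove
  have : Measurable fun u : ℝ≥0 => ⌊((n : ℝ≥0) + 1) * u⌋₊ :=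
    Nat.measurable_floor.comp (measurable_const.mul measurable_id)
  have h2 : Measurable fun k : ℕ => ((k : ℝ≥0) + 1) / ((n : ℝ≥0) + 1) := measurable_of_countable _
  exact h2.comp this

theorem measurable_eval_gridAbove {E : Type*} [MeasurableSpace E] (n : ℕ) :
    Measurable fun p : (ℝ≥0 → E) × ℝ≥0 => p.1 (gridAbove n p.2) := by
  have h1 : Measurable fun p : (ℝ≥0 → E) × ℕ => p.1 (((p.2 : ℝ≥0) + 1) / ((n : ℝ≥0) + 1)) :=
    measurable_from_prod_countable_left fun k =>
      measurable_pi_apply (((k : ℝ≥0) + 1) / ((n : ℝ≥0) + 1))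
  have h2 : Measurable fun u : ℝ≥0 => ⌊((n : ℝ≥0) + 1) * u⌋₊ :=
    Nat.measurable_floor.comp (measurable_const.mul measurable_id)
  exact h1.comp (measurable_fst.prodMk (h2.comp measurable_snd))

variable {Ω E : Type*} [MeasurableSpace Ω] {P : Measure Ω} {X : ℝ≥0 → Ω → E}
  {τ : Ω → ℝ≥0}

theorem ae_tendsto_gridAbove [TopologicalSpace E]
    (hrc : ∀ᵐ ω ∂P, ∀ t : ℝ≥0, ContinuousWithinAt (fun u => X u ω) (Ici t) t) :
    ∀ᵐ ω ∂P, Tendsto (fun n => X (gridAbove n (τ ω)) ω) atTop (𝓝 (X (τ ω) ω)) := by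
  filter_upwards [hrc] with ω hω
  exact (hω (τ ω)).tendsto.comp (tendsto_gridAbove (τ ω))

theorem measurable_comp_gridAbove [MeasurableSpace E] (hX : ∀ t, Measurable (X t))
    (hτ : Measurable τ) (n : ℕ) : Measurable fun ω => X (gridAbove n (τ ω)) ω :=
  (measurable_eval_gridAbove n).comp
    ((measurable_pi_lambda (fun ω s => X s ω) hX).prodMk hτ)

variable [NormedAddCommGroup E] [MeasurableSpace E] [BorelSpace E]

theorem aemeasurable_randomTime (hX : ∀ t, Measurable (X t))
    (hrc : ∀ᵐ ω ∂P, ∀ t : ℝ≥0, ContinuousWithinAt (fun u => X u ω) (Ici t) t)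
    (hτ : Measurable τ) : AEMeasurable (fun ω => X (τ ω) ω) P :=
  aemeasurable_of_tendsto_metrizable_ae atTop
    (fun n => (measurable_comp_gridAbove hX hτ n).aemeasurable) (ae_tendsto_gridAbove hrc)

/-- A right-continuous process evaluated at an independent random time `τ` has characteristic
function `𝔼 ψ(τ)`, where `ψ s` is the characteristic function at time `s`. For times with
values in a countable grid this is Fubini's theorem; the general case follows by approximating `τ`
from the right. -/
theorem charFun_map_randomTime [IsProbabilityMeasure P] [InnerProductSpace ℝ E]
    [SecondCountableTopology E] (hX : ∀ t, Measurable (X t))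
    (hrc : ∀ᵐ ω ∂P, ∀ t : ℝ≥0, ContinuousWithinAt (fun u => X u ω) (Ici t) t)
    (hτ : Measurable τ) (hind : IndepFun (fun ω s => X s ω) τ P) {ξ : E} {ψ : ℝ≥0 → ℂ}
    (hψ : Continuous ψ) (hψX : ∀ s, charFun (P.map (X s)) ξ = ψ s) :
    charFun (P.map fun ω => X (τ ω) ω) ξ = ∫ ω, ψ (τ ω) ∂P := by
  have hpath : Measurable fun ω s => X s ω := measurable_pi_lambda _ hX
  have hchar : Measurable fun x : E => Complex.exp (inner ℝ x ξ * Complex.I) :=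
    Continuous.measurable (by fun_prop)
  have hnorm : ∀ x : E, ‖Complex.exp (inner ℝ x ξ * Complex.I)‖ = 1 := fun x =>
    Complex.norm_exp_ofReal_mul_I _
  have hψ1 : ∀ s, ‖ψ s‖ ≤ 1 := fun s => by
    have := Measure.isProbabilityMeasure_map (μ := P) (hX s).aemeasurable
    rw [← hψX s]
    exact norm_charFun_le_one _
  have hgrid : ∀ n, ∫ ω, Complex.exp (inner ℝ (X (gridAbove n (τ ω)) ω) ξ * Complex.I) ∂P =
      ∫ ω, ψ (gridAbove n (τ ω)) ∂P := by
    intro n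
    have hprob1 := Measure.isProbabilityMeasure_map (μ := P) hpath.aemeasurable
    have hprob2 := Measure.isProbabilityMeasure_map (μ := P) hτ.aemeasurable
    have hmeas : Measurable fun p : (ℝ≥0 → E) × ℝ≥0 =>
        Complex.exp (inner ℝ (p.1 (gridAbove n p.2)) ξ * Complex.I) :=
      hchar.comp (measurable_eval_gridAbove n)
    have hprod := (indepFun_iff_map_prod_eq_prod_map_map hpath.aemeasurable
      hτ.aemeasurable).1 hind
    calc ∫ ω, Complex.exp (inner ℝ (X (gridAbove n (τ ω)) ω) ξ * Complex.I) ∂P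
        = ∫ p, Complex.exp (inner ℝ (p.1 (gridAbove n p.2)) ξ * Complex.I)
            ∂(P.map fun ω => ((fun s => X s ω), τ ω)) := by
          rw [integral_map (hpath.prodMk hτ).aemeasurable hmeas.aestronglyMeasurable]
      _ = ∫ u, (∫ x, Complex.exp (inner ℝ (x (gridAbove n u)) ξ * Complex.I)
            ∂(P.map fun ω s => X s ω)) ∂(P.map τ) := by
          rw [hprod, integral_prod_symm]
          exact Integrable.of_bound hmeas.aestronglyMeasurable 1
            (Eventually.of_forall fun p => (hnorm _).le)
      _ = ∫ u, ψ (gridAbove n u) ∂(P.map τ) := by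
          refine integral_congr_ae (Eventually.of_forall fun u => ?_)
          simp only
          rw [← hψX, charFun_apply, integral_map hpath.aemeasurable
            (f := fun x : ℝ≥0 → E => Complex.exp (inner ℝ (x (gridAbove n u)) ξ * Complex.I))
            (hchar.comp (measurable_pi_apply _)).aestronglyMeasurable,
            integral_map (hX _).aemeasurable hchar.aestronglyMeasurable]
      _ = ∫ ω, ψ (gridAbove n (τ ω)) ∂P := by
          rw [integral_map hτ.aemeasurable (f := fun u => ψ (gridAbove n u))
            (hψ.measurable.comp (measurable_gridAbove n)).aestronglyMeasurable]
  rw [charFun_apply, integral_map (aemeasurable_randomTime hX hrc hτ)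
    hchar.aestronglyMeasurable]
  have hl1 : Tendsto
      (fun n => ∫ ω, Complex.exp (inner ℝ (X (gridAbove n (τ ω)) ω) ξ * Complex.I) ∂P) atTop
      (𝓝 (∫ ω, Complex.exp (inner ℝ (X (τ ω) ω) ξ * Complex.I) ∂P)) := by
    refine tendsto_integral_of_dominated_convergence (fun _ => 1)
      (fun n => (hchar.comp (measurable_comp_gridAbove hX hτ n)).aestronglyMeasurable)
      (integrable_const _) (fun n => Eventually.of_forall fun ω => (hnorm _).le) ?_
    filter_upwards [ae_tendsto_gridAbove (τ := τ) hrc] with ω hω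
    have hc : Continuous fun x : E => Complex.exp (inner ℝ x ξ * Complex.I) := by fun_prop
    exact (hc.tendsto _).comp hω
  have hl2 : Tendsto (fun n => ∫ ω, ψ (gridAbove n (τ ω)) ∂P) atTop
      (𝓝 (∫ ω, ψ (τ ω) ∂P)) := by
    refine tendsto_integral_of_dominated_convergence (fun _ => 1)
      (fun n => (hψ.measurable.comp ((measurable_gridAbove n).comp hτ)).aestronglyMeasurable)
      (integrable_const _) (fun n => Eventually.of_forall fun ω => hψ1 _)
      (Eventually.of_forall fun ω => ?_)
    exact (hψ.tendsto _).comp ((tendsto_gridAbove (τ ω)).mono_right nhdsWithin_le_nhds)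
  simp only [hgrid] at hl1
  exact tendsto_nhds_unique hl1 hl2

end RandomTime

/-! ### First passage times of a stable subordinator -/

section FirstPassage

/-- The first passage time of a path above `t`, computed along rational times only. It is a
measurable function of the path and agrees with `firstPassage` for monotone paths. As for
`firstPassage`, its value is `0` if `t` is never exceeded. -/
noncomputable def rationalPassage (t : ℝ) (x : ℝ≥0 → ℝ) : ℝ≥0 :=
  (⨅ q : ℚ≥0, if t < x (q : ℝ≥0) then ((q : ℝ≥0) : ℝ≥0∞) else ⊤).toNNReal

theorem measurable_rationalPassage (t : ℝ) : Measurable (rationalPassage t) :=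
  ENNReal.measurable_toNNReal.comp <| Measurable.iInf fun _ =>
    Measurable.ite (measurableSet_lt measurable_const (measurable_pi_apply _))
      measurable_const measurable_const

theorem rationalPassage_eq_sInf {t : ℝ} {x : ℝ≥0 → ℝ} (hx : Monotone x) :
    rationalPassage t x = sInf {u : ℝ≥0 | t < x u} := by
  rcases Set.eq_empty_or_nonempty {u : ℝ≥0 | t < x u} with h | h
  · have h' : ∀ u, ¬ t < x u := fun u hu => by
      have : u ∈ {u : ℝ≥0 | t < x u} := hu
      simp [h] at this
    simp [rationalPassage, h']
  · have key : (⨅ q : ℚ≥0, if t < x (q : ℝ≥0) then ((q : ℝ≥0) : ℝ≥0∞) else ⊤) =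
        ((sInf {u : ℝ≥0 | t < x u} : ℝ≥0) : ℝ≥0∞) := by
      refine le_antisymm (le_of_forall_gt fun c hc => ?_) (le_iInf fun q => ?_)
      · obtain ⟨b, hb1, hb2⟩ := ENNReal.lt_iff_exists_nnreal_btwn.1 hc
        obtain ⟨u, hu, hub⟩ := exists_lt_of_csInf_lt h (ENNReal.coe_lt_coe.1 hb1)
        obtain ⟨q, hq1, hq2⟩ := exists_rat_btwn (NNReal.coe_lt_coe.2 hub)
        have hq0 : 0 ≤ q := by
          have : (0 : ℝ) ≤ q := u.2.trans hq1.le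
          exact_mod_cast this
        lift q to ℚ≥0 using hq0
        have e : ((q : ℝ≥0) : ℝ) = ((q : ℚ) : ℝ) := rfl
        rw [← e] at hq1 hq2
        have hq1' : u < (q : ℝ≥0) := NNReal.coe_lt_coe.1 hq1
        have hq2' : (q : ℝ≥0) < b := NNReal.coe_lt_coe.1 hq2
        have hut : t < x u := hu
        refine (iInf_le _ q).trans_lt ?_
        rw [if_pos (hut.trans_le (hx hq1'.le))]
        exact (ENNReal.coe_lt_coe.2 hq2').trans hb2
      · split_ifs with hq
        · exact ENNReal.coe_le_coe.2 (csInf_le (OrderBot.bddBelow _) hq)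
        · exact le_top
    rw [rationalPassage, key, ENNReal.toNNReal_coe]

variable {Ω : Type*} [MeasurableSpace Ω] {β : ℝ} {D : ℝ≥0 → Ω → ℝ} {P : Measure Ω}

namespace IsStableSubordinator

theorem nonneg (hD : IsStableSubordinator β D P) : ∀ᵐ ω ∂P, ∀ r, 0 ≤ D r ω := by
  filter_upwards [hD.zero, hD.monotone] with ω h0 hm r
  rw [← h0]
  exact hm zero_le

theorem isPositiveStable (hD : IsStableSubordinator β D P) : IsPositiveStable β (D 1) P where
  measurable := hD.measurable 1
  nonneg := hD.nonneg.mono fun _ h => h 1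
  laplace_eq l hl := by simpa using hD.laplace_eq 1 l hl

/-- Self-similarity: `D_r` has the law of `r^{1/β} D_1`. -/
theorem map_eq [IsProbabilityMeasure P]
    (hD : IsStableSubordinator β D P) (hβ : 0 < β) {r : ℝ≥0} (hr : 0 < r) :
    P.map (D r) = P.map fun ω => (r : ℝ) ^ β⁻¹ * D 1 ω := by
  have hr' : (0 : ℝ) < r := hr
  have h1 := hD.measurable 1
  refine map_eq_of_laplace_eq (hD.measurable r).aemeasurable (by fun_prop)
    (hD.nonneg.mono fun ω h => h r) ?_ fun l hl => ?_
  · filter_upwards [hD.nonneg] with ω h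
    have := h 1
    positivity
  · have h := hD.laplace_eq 1 (l * (r : ℝ) ^ β⁻¹) (by positivity)
    rw [Real.mul_rpow hl.le (by positivity), Real.rpow_inv_rpow hr'.le hβ.ne'] at h
    rw [hD.laplace_eq r l hl]
    simp only [← mul_assoc]
    rw [h]
    simp [mul_comm]

/-- Every level is eventually exceeded, so that the infimum defining `firstPassage` is almost surely
not taken over the empty set. -/
theorem ae_exists_lt [IsProbabilityMeasure P] (hD : IsStableSubordinator β D P) (t : ℝ) :
    ∀ᵐ ω ∂P, ∃ u, t < D u ω := by
  have hle : ∀ n : ℕ, P.real {ω | ∀ u, D u ω ≤ t} ≤ Real.exp t * Real.exp (-(n : ℝ)) := by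
    intro n
    have hint : Integrable (fun ω => Real.exp (-(1 * D n ω))) P := by
      simpa using integrable_exp_mul_of_nonpos (hD.measurable n).aemeasurable
        (hD.nonneg.mono fun ω h => h n) (t := -1) (by norm_num)
    have h := mul_meas_ge_le_integral_of_nonneg
      (Eventually.of_forall fun ω => (Real.exp_pos (-(1 * D n ω))).le) hint (Real.exp (-t))
    rw [hD.laplace_eq n 1 one_pos] at h
    have hsub : P.real {ω | ∀ u, D u ω ≤ t} ≤
        P.real {ω | Real.exp (-t) ≤ Real.exp (-(1 * D n ω))} := by
      refine measureReal_mono fun ω hω => ?_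
      have hω' : ∀ u, D u ω ≤ t := hω
      show Real.exp (-t) ≤ Real.exp (-(1 * D n ω))
      rw [Real.exp_le_exp]
      linarith [hω' n]
    have e : Real.exp t * Real.exp (-t) = 1 := by rw [← Real.exp_add]; simp
    have h2 := mul_le_mul_of_nonneg_left ((mul_le_mul_of_nonneg_left hsub
      (Real.exp_pos (-t)).le).trans h) (Real.exp_pos t).le
    rw [← mul_assoc, e, one_mul] at h2
    simpa using h2
  have hlim : Tendsto (fun n : ℕ => Real.exp t * Real.exp (-(n : ℝ))) atTop (𝓝 0) := by
    simpa using (Real.tendsto_exp_neg_atTop_nhds_zero.comp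
      tendsto_natCast_atTop_atTop).const_mul (Real.exp t)
  have h0 : P.real {ω | ∀ u, D u ω ≤ t} = 0 :=
    le_antisymm (ge_of_tendsto' hlim hle) measureReal_nonneg
  rw [measureReal_eq_zero_iff] at h0
  simpa [ae_iff] using h0

theorem firstPassage_ae_eq (hD : IsStableSubordinator β D P) (t : ℝ) :
    firstPassage D t =ᵐ[P] fun ω => rationalPassage t fun r => D r ω := by
  filter_upwards [hD.monotone] with ω hω
  exact (rationalPassage_eq_sInf hω).symm

theorem aemeasurable_firstPassage (hD : IsStableSubordinator β D P) (t : ℝ) :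
    AEMeasurable (firstPassage D t) P :=
  ((measurable_rationalPassage t).comp
    (measurable_pi_lambda (fun ω r => D r ω) hD.measurable)).aemeasurable.congr
      (hD.firstPassage_ae_eq t).symm

theorem measure_le_eq [IsProbabilityMeasure P]
    (hD : IsStableSubordinator β D P) (hβ : 0 < β) {t : ℝ} (ht : 0 < t)
    {v : ℝ≥0} (hv : 0 < v) :
    P {ω | D v ω ≤ t} = P {ω | (v : ℝ) ≤ (t / D 1 ω) ^ β} := by
  have h1 := hD.measurable 1
  have e : P {ω | D v ω ≤ t} = P {ω | (v : ℝ) ^ β⁻¹ * D 1 ω ≤ t} := by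
    have h : P.map (D v) (Iic t) = P.map (fun ω => (v : ℝ) ^ β⁻¹ * D 1 ω) (Iic t) := by
      rw [hD.map_eq hβ hv]
    rwa [Measure.map_apply (hD.measurable v) measurableSet_Iic,
      Measure.map_apply (by fun_prop) measurableSet_Iic] at h
  rw [e]
  refine measure_congr ?_
  filter_upwards [hD.isPositiveStable.pos hβ] with ω hω
  refine propext ?_
  show (v : ℝ) ^ β⁻¹ * D 1 ω ≤ t ↔ (v : ℝ) ≤ (t / D 1 ω) ^ β
  rw [← le_div_iff₀ hω, Real.rpow_inv_le_iff_of_pos v.coe_nonneg (by positivity) hβ]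

/-- The first passage time `E_t` has the law of `(t / D_1)^β`. The events `{E_t ≥ u}` and
`{D_v ≤ t}` are compared for `v` equal to and slightly below `u`. -/
theorem map_firstPassage [IsProbabilityMeasure P]
    (hD : IsStableSubordinator β D P) (hβ : 0 < β) {t : ℝ} (ht : 0 < t) :
    P.map (fun ω => (firstPassage D t ω : ℝ)) = P.map fun ω => (t / D 1 ω) ^ β := by
  have h1 := hD.measurable 1
  have hE : AEMeasurable (fun ω => (firstPassage D t ω : ℝ)) P :=
    (hD.aemeasurable_firstPassage t).coe_nnreal_real
  have hW : Measurable fun ω => (t / D 1 ω) ^ β := by fun_prop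
  have hprob1 := Measure.isProbabilityMeasure_map hE
  have hprob2 := Measure.isProbabilityMeasure_map (μ := P) hW.aemeasurable
  have hapW : ∀ a, P.map (fun ω => (t / D 1 ω) ^ β) (Ici a) =
      P {ω | a ≤ (t / D 1 ω) ^ β} := fun a => Measure.map_apply hW measurableSet_Ici
  have hapE : ∀ a, P.map (fun ω => (firstPassage D t ω : ℝ)) (Ici a) =
      P {ω | a ≤ (firstPassage D t ω : ℝ)} := fun a =>
    Measure.map_apply_of_aemeasurable hE measurableSet_Ici
  refine Measure.ext_of_Ici _ _ fun a => ?_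
  rcases le_or_gt a 0 with ha | ha
  · rw [hapW, hapE]
    refine measure_congr ?_
    filter_upwards [hD.isPositiveStable.pos hβ] with ω hω
    refine propext ⟨fun _ => ?_, fun _ => ?_⟩
    · show a ≤ (t / D 1 ω) ^ β
      exact ha.trans (by positivity)
    · show a ≤ (firstPassage D t ω : ℝ)
      exact ha.trans (NNReal.coe_nonneg _)
  · refine le_antisymm ?_ ?_
    · obtain ⟨v, hvmono, hv, hvlim⟩ := exists_seq_strictMono_tendsto' ha
      have hIci : Ici a = ⋂ n, Ici (v n) := by
        ext x
        simp only [mem_Ici, mem_iInter]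
        exact ⟨fun h n => (hv n).2.le.trans h, fun h => le_of_tendsto' hvlim h⟩
      have hlim : Tendsto (fun n => P.map (fun ω => (t / D 1 ω) ^ β) (Ici (v n))) atTop
          (𝓝 (P.map (fun ω => (t / D 1 ω) ^ β) (Ici a))) := by
        rw [hIci]
        exact tendsto_measure_iInter_atTop (fun n => measurableSet_Ici.nullMeasurableSet)
          (fun m n hmn => Ici_subset_Ici.2 (hvmono.monotone hmn)) ⟨0, measure_ne_top _ _⟩
      refine ge_of_tendsto' hlim fun n => ?_
      have h2 := hD.measure_le_eq hβ ht (v := (v n).toNNReal) (Real.toNNReal_pos.2 (hv n).1)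
      rw [Real.coe_toNNReal _ (hv n).1.le] at h2
      rw [hapE, hapW, ← h2]
      refine measure_mono fun ω hω => ?_
      have hω' : a ≤ (firstPassage D t ω : ℝ) := hω
      show D (v n).toNNReal ω ≤ t
      by_contra! hlt
      have h3 : firstPassage D t ω ≤ (v n).toNNReal := csInf_le (OrderBot.bddBelow _) hlt
      have h4 : (firstPassage D t ω : ℝ) ≤ v n := by
        rw [← Real.coe_toNNReal _ (hv n).1.le]
        exact h3
      linarith [(hv n).2]
    · have h2 := hD.measure_le_eq hβ ht (v := a.toNNReal) (Real.toNNReal_pos.2 ha)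
      rw [Real.coe_toNNReal _ ha.le] at h2
      rw [hapE, hapW, ← h2]
      refine measure_mono_ae ?_
      filter_upwards [hD.monotone, hD.ae_exists_lt t] with ω hm hex hω
      have hω' : D a.toNNReal ω ≤ t := hω
      have : a.toNNReal ≤ firstPassage D t ω := by
        refine le_csInf hex fun u hu => ?_
        by_contra! hlt
        have hu' : t < D u ω := hu
        linarith [hm hlt.le]
      exact Real.toNNReal_le_iff_le_coe.1 this

theorem integral_exp_neg_firstPassage [IsProbabilityMeasure P]
    (hD : IsStableSubordinator β D P) (hβ : 0 < β) {t : ℝ}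
    (ht : 0 < t) {l : ℝ} (hl : 0 ≤ l) :
    ∫ ω, Real.exp (-(l * firstPassage D t ω)) ∂P = mittagLeffler β (-(l * t ^ β)) := by
  have h1 := hD.measurable 1
  have hE : AEMeasurable (fun ω => (firstPassage D t ω : ℝ)) P :=
    (hD.aemeasurable_firstPassage t).coe_nnreal_real
  have hexp : Measurable fun u : ℝ => Real.exp (-(l * u)) := by fun_prop
  rw [hD.isPositiveStable.mittagLeffler_neg hβ (by positivity),
    ← integral_map hE hexp.aestronglyMeasurable, hD.map_firstPassage hβ ht,
    integral_map (by fun_prop) hexp.aestronglyMeasurable]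
  refine integral_congr_ae ?_
  filter_upwards [hD.isPositiveStable.pos hβ] with ω hω
  rw [Real.div_rpow ht.le hω.le, Real.rpow_neg hω.le, div_eq_mul_inv, mul_assoc]

end IsStableSubordinator

end FirstPassage

/-! ### Radial integrals -/

theorem rpow_mul_comp_rpow_eq {b α κ : ℝ} (hα : 0 < α) (hκ : 0 < κ) (g : ℝ → ℝ) {x : ℝ}
    (hx : 0 < x) :
    x ^ (b - 1) * g (κ * x ^ α) = (α * x ^ (α - 1)) •
      ((fun y : ℝ => (fun z : ℝ => z ^ (b / α - 1) * g z) (κ * y)) (x ^ α) *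
        (α⁻¹ * κ ^ (1 - b / α))) := by
  have h1 : x ^ (b - 1) = x ^ (α - 1) * (x ^ α) ^ (b / α - 1) := by
    rw [← Real.rpow_mul hx.le, ← Real.rpow_add hx]
    congr 1
    field_simp
    ring
  have h2 : κ ^ (1 - b / α) * κ ^ (b / α - 1) = 1 := by
    rw [← Real.rpow_add hκ]; simp
  simp only [smul_eq_mul]
  rw [h1, Real.mul_rpow hκ.le (by positivity)]
  calc x ^ (α - 1) * (x ^ α) ^ (b / α - 1) * g (κ * x ^ α)
      = (α * α⁻¹) * (κ ^ (1 - b / α) * κ ^ (b / α - 1)) *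
          (x ^ (α - 1) * (x ^ α) ^ (b / α - 1) * g (κ * x ^ α)) := by
        rw [h2, mul_inv_cancel₀ hα.ne', one_mul, one_mul]
    _ = _ := by ring

/-- The substitution `z = κ x^α`. -/
theorem integral_rpow_mul_comp_rpow {b α κ : ℝ} (hα : 0 < α) (hκ : 0 < κ) (g : ℝ → ℝ) :
    ∫ x in Ioi (0 : ℝ), x ^ (b - 1) * g (κ * x ^ α) =
      α⁻¹ * κ ^ (-(b / α)) * ∫ z in Ioi (0 : ℝ), z ^ (b / α - 1) * g z := by
  rw [setIntegral_congr_fun measurableSet_Ioi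
      fun x hx => rpow_mul_comp_rpow_eq (b := b) hα hκ g hx,
    integral_comp_rpow_Ioi_of_pos (g := fun y => (fun z : ℝ => z ^ (b / α - 1) * g z) (κ * y) *
      (α⁻¹ * κ ^ (1 - b / α))) hα, integral_mul_const,
    integral_comp_mul_left_Ioi (fun z : ℝ => z ^ (b / α - 1) * g z) 0 hκ, mul_zero, smul_eq_mul]
  have : κ ^ (1 - b / α) = κ * κ ^ (-(b / α)) := by
    rw [sub_eq_add_neg, Real.rpow_add hκ, Real.rpow_one]
  rw [this]
  field_simp

theorem integrableOn_rpow_mul_comp_rpow {b α κ : ℝ} (hα : 0 < α) (hκ : 0 < κ) {g : ℝ → ℝ}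
    (hg : IntegrableOn (fun z : ℝ => z ^ (b / α - 1) * g z) (Ioi 0)) :
    IntegrableOn (fun x : ℝ => x ^ (b - 1) * g (κ * x ^ α)) (Ioi 0) := by
  have h1 : IntegrableOn (fun y => (fun z : ℝ => z ^ (b / α - 1) * g z) (κ * y) *
      (α⁻¹ * κ ^ (1 - b / α))) (Ioi 0) := by
    refine Integrable.mul_const ?_ _
    refine (integrableOn_Ioi_comp_mul_left_iff
      (fun z : ℝ => z ^ (b / α - 1) * g z) 0 hκ).2 ?_
    rwa [mul_zero]
  have h2 := ((integrableOn_Ioi_comp_rpow_iff' _ hα.ne').2 h1).smul α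
  refine IntegrableOn.congr_fun h2 (fun x hx => ?_) measurableSet_Ioi
  rw [rpow_mul_comp_rpow_eq hα hκ g hx]
  simp only [smul_eq_mul, Pi.smul_apply]
  ring

/-- The surface area of the unit sphere of `ℝ^d` is `2 π^{d/2} / Γ(d/2)`. -/
theorem natCast_mul_volume_unitBall {d : ℕ} (hd : 0 < d) :
    (d : ℝ) * volume.real (Metric.ball (0 : EuclideanSpace ℝ (Fin d)) 1) =
      2 * Real.pi ^ ((d : ℝ) / 2) / Real.Gamma ((d : ℝ) / 2) := by
  have : Nonempty (Fin d) := ⟨⟨0, hd⟩⟩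
  have hd' : (0 : ℝ) < d := by exact_mod_cast hd
  have hΓ : 0 < Real.Gamma ((d : ℝ) / 2) := Real.Gamma_pos_of_pos (by positivity)
  have hΓ1 : 0 < Real.Gamma ((d : ℝ) / 2 + 1) := Real.Gamma_pos_of_pos (by positivity)
  rw [Measure.real, EuclideanSpace.volume_ball, Fintype.card_fin, ENNReal.ofReal_one, one_pow,
    one_mul, ENNReal.toReal_ofReal (by positivity), Real.Gamma_add_one (by positivity),
    Real.sqrt_eq_rpow, ← Real.rpow_natCast, ← Real.rpow_mul Real.pi_pos.le]
  have : (1 : ℝ) / 2 * d = d / 2 := by ring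
  rw [this]
  field_simp

section Radial

variable {d : ℕ} {α κ : ℝ} {g : ℝ → ℝ}

theorem integrable_radial (hd : 0 < d) (hα : 0 < α) (hκ : 0 < κ)
    (hg : IntegrableOn (fun z : ℝ => z ^ ((d : ℝ) / α - 1) * g z) (Ioi 0)) :
    Integrable (fun ξ : EuclideanSpace ℝ (Fin d) => g (κ * ‖ξ‖ ^ α)) := by
  have : Nonempty (Fin d) := ⟨⟨0, hd⟩⟩
  rw [integrable_fun_norm_addHaar volume (f := fun r => g (κ * r ^ α))]
  refine (integrableOn_rpow_mul_comp_rpow hα hκ hg).congr_fun (fun x hx => ?_) measurableSet_Ioi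
  simp only [finrank_euclideanSpace, Fintype.card_fin, smul_eq_mul]
  rw [← Real.rpow_natCast, Nat.cast_sub hd, Nat.cast_one]

theorem integral_radial (hd : 0 < d) (hα : 0 < α) (hκ : 0 < κ) :
    ∫ ξ : EuclideanSpace ℝ (Fin d), g (κ * ‖ξ‖ ^ α) =
      2 * Real.pi ^ ((d : ℝ) / 2) / Real.Gamma ((d : ℝ) / 2) *
        (α⁻¹ * κ ^ (-((d : ℝ) / α)) * ∫ z in Ioi (0 : ℝ), z ^ ((d : ℝ) / α - 1) * g z) := by
  have : Nonempty (Fin d) := ⟨⟨0, hd⟩⟩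
  rw [integral_fun_norm_addHaar volume (fun r => g (κ * r ^ α)),
    ← natCast_mul_volume_unitBall hd, ← integral_rpow_mul_comp_rpow hα hκ g]
  simp only [finrank_euclideanSpace, Fintype.card_fin, smul_eq_mul, nsmul_eq_mul]
  rw [mul_assoc]
  congr 2
  refine setIntegral_congr_fun measurableSet_Ioi fun x hx => ?_
  rw [← Real.rpow_natCast, Nat.cast_sub hd, Nat.cast_one]

end Radial

/-! ### The law of the time-changed process -/

section TimeChange

variable {d : ℕ} {α β ν : ℝ} {Ω : Type*} [MeasurableSpace Ω] {P : Measure Ω}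
  {X : ℝ≥0 → Ω → EuclideanSpace ℝ (Fin d)} {D : ℝ≥0 → Ω → ℝ}

theorem timeChanged_ae_eq (hD : IsStableSubordinator β D P) (t : ℝ) :
    timeChanged X D t =ᵐ[P] fun ω => X (rationalPassage t fun r => D r ω) ω := by
  filter_upwards [hD.firstPassage_ae_eq t] with ω hω
  rw [timeChanged, hω]

theorem aemeasurable_timeChanged (hX : IsIsotropicStableProcess α ν X P)
    (hD : IsStableSubordinator β D P) (t : ℝ) : AEMeasurable (timeChanged X D t) P :=
  (aemeasurable_randomTime hX.measurable (hX.cadlag.mono fun _ h s => (h s).1)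
    ((measurable_rationalPassage t).comp
      (measurable_pi_lambda (fun ω r => D r ω) hD.measurable))).congr (timeChanged_ae_eq hD t).symm

theorem charFun_timeChanged [IsProbabilityMeasure P] (hX : IsIsotropicStableProcess α ν X P)
    (hD : IsStableSubordinator β D P)
    (hXD : IndepFun (fun ω s => X s ω) (fun ω r => D r ω) P) (hβ : 0 < β) (hν : 0 < ν)
    {t : ℝ} (ht : 0 < t) (ξ : EuclideanSpace ℝ (Fin d)) :
    charFun (P.map (timeChanged X D t)) ξ =
      (mittagLeffler β (-(ν * ‖ξ‖ ^ α * t ^ β)) : ℂ) := by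
  have hτ : Measurable fun ω => rationalPassage t fun r => D r ω :=
    (measurable_rationalPassage t).comp (measurable_pi_lambda (fun ω r => D r ω) hD.measurable)
  rw [Measure.map_congr (timeChanged_ae_eq hD t),
    charFun_map_randomTime hX.measurable (hX.cadlag.mono fun _ h s => (h s).1) hτ
      (hXD.comp measurable_id (measurable_rationalPassage t))
      (ψ := fun s => Complex.exp (-((s * ν * ‖ξ‖ ^ α : ℝ) : ℂ))) (by fun_prop)
      (fun s => hX.charFun_eq s ξ),
    ← hD.integral_exp_neg_firstPassage hβ ht (by positivity), ← integral_complex_ofReal]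
  refine integral_congr_ae ?_
  filter_upwards [hD.firstPassage_ae_eq t] with ω hω
  rw [hω]
  push_cast
  ring_nf

end TimeChange

theorem mainTheorem8 {d : ℕ} (hd : 0 < d) {α β ν : ℝ} (hα : 0 < α) (hα2 : α ≤ 2)
    (hβ : 0 < β) (hβ1 : β < 1) (hν : 0 < ν)
    {Ω : Type*} [MeasurableSpace Ω] (P : Measure Ω) [IsProbabilityMeasure P]
    (X : ℝ≥0 → Ω → EuclideanSpace ℝ (Fin d)) (D : ℝ≥0 → Ω → ℝ)
    (hX : IsIsotropicStableProcess α ν X P) (hD : IsStableSubordinator β D P)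
    (hXD : IndepFun (fun ω s => X s ω) (fun ω r => D r ω) P) :
    (IntegrableOn (fun z : ℝ => z ^ ((d : ℝ) / α - 1) * mittagLeffler β (-z) ^ 2) (Ioi 0) volume ↔
        (d : ℝ) < 2 * α) ∧
      ((d : ℝ) < 2 * α → ∀ t : ℝ, 0 < t →
        HasPDF (timeChanged X D t) P volume ∧
        Integrable (fun x => greenKernel P X D t x ^ 2) volume ∧
        ∫ x, greenKernel P X D t x ^ 2 = greenConst d α β ν * t ^ (-(β * d / α))) := by
  have hd' : (0 : ℝ) < d := by exact_mod_cast hd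
  have hiff : IntegrableOn (fun z : ℝ => z ^ ((d : ℝ) / α - 1) * mittagLeffler β (-z) ^ 2)
      (Ioi 0) volume ↔ (d : ℝ) < 2 * α := by
    rw [hD.isPositiveStable.integrableOn_rpow_mul_mittagLeffler_sq_iff hβ hβ1
      (a := (d : ℝ) / α) (by positivity), div_lt_iff₀ hα]
  refine ⟨hiff, fun hdα t ht => ?_⟩
  set μ := P.map (timeChanged X D t) with hμ
  have hmeas := aemeasurable_timeChanged hX hD t
  have hprob : IsProbabilityMeasure μ := Measure.isProbabilityMeasure_map hmeas
  -- The scale `κ` collects the factor `2 π` of the Fourier transform, `ν` and `t ^ β`.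
  set κ : ℝ := ν * (2 * Real.pi) ^ α * t ^ β with hκdef
  have hκ : 0 < κ := by have := Real.pi_pos; positivity
  have hchar : ∀ ξ : EuclideanSpace ℝ (Fin d),
      ‖charFun μ ((2 * Real.pi) • ξ)‖ ^ 2 = mittagLeffler β (-(κ * ‖ξ‖ ^ α)) ^ 2 := by
    intro ξ
    have hpi : (0 : ℝ) ≤ 2 * Real.pi := by have := Real.pi_pos; positivity
    rw [hμ, charFun_timeChanged hX hD hXD hβ hν ht, Complex.norm_real, Real.norm_eq_abs, sq_abs,
      norm_smul, Real.norm_of_nonneg hpi, Real.mul_rpow hpi (norm_nonneg _), hκdef]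
    ring_nf
  have hL2 : MemLp (fun ξ : EuclideanSpace ℝ (Fin d) => charFun μ ((2 * Real.pi) • ξ)) 2
      volume := by
    have hm : AEStronglyMeasurable
        (fun ξ : EuclideanSpace ℝ (Fin d) => charFun μ ((2 * Real.pi) • ξ)) volume :=
      (measurable_charFun.comp (measurable_const_smul (2 * Real.pi))).aestronglyMeasurable
    rw [← memLp_norm_iff hm, memLp_two_iff_integrable_sq hm.norm]
    simp only [hchar]
    exact integrable_radial hd hα hκ (g := fun z => mittagLeffler β (-z) ^ 2) (hiff.2 hdα)
  obtain ⟨hac, hmem, hint⟩ := absolutelyContinuous_and_integral_rnDeriv_sq hL2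
  refine ⟨hasPDF_iff.2 ⟨hmeas, inferInstance, hac⟩, hmem.integrable_sq, ?_⟩
  have hgreen : ∫ x, greenKernel P X D t x ^ 2 =
      ∫ x, (μ.rnDeriv volume x).toReal ^ 2 := rfl
  rw [hgreen, hint]
  simp only [hchar]
  rw [integral_radial hd hα hκ (g := fun z => mittagLeffler β (-z) ^ 2), greenConst]
  have hκpow : κ ^ (-((d : ℝ) / α)) =
      ν ^ (-((d : ℝ) / α)) * (1 / (2 * Real.pi) ^ d) * t ^ (-(β * d / α)) := by
    have hpi := Real.pi_pos
    rw [hκdef, Real.mul_rpow (by positivity) (by positivity),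
      Real.mul_rpow hν.le (by positivity), ← Real.rpow_mul (by positivity), ← Real.rpow_mul ht.le]
    have e1 : α * -((d : ℝ) / α) = -(d : ℝ) := by field_simp
    have e2 : β * -((d : ℝ) / α) = -(β * d / α) := by ring
    rw [e1, e2, Real.rpow_neg (by positivity) (d : ℝ), Real.rpow_natCast, one_div]
  rw [hκpow]
  have hΓ : 0 < Real.Gamma ((d : ℝ) / 2) := Real.Gamma_pos_of_pos (by positivity)
  field_simp
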